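/- Let $p$ be a prime, $K$ a finite extension of $\mathbb{Q}_p$ with ramification index $e$ and residue field of $p^f$ elements, let $|\cdot|_p$ be the absolute value of $K$ extending the $p$-adic one, $\mathcal{O}_K=\{x\in K:|x|_p\le 1\}$, and let $\pi$ be a uniformizer. Let $\mathcal{O}_K\langle x\rangle$ be the set of power series $\sum_{i\ge0}a_ix^i$ with $a_i\in\mathcal{O}_K$ and $a_i\to0$; each of them defines a map $\mathcal{O}_K\to\mathcal{O}_K$. Definitions. For $\phi\in\mathcal{O}_K\langle x\rangle$ and $n\ge1$, a $k$-cycle at level $n$ is a cycle $\sigma$ of length $k\ge 1$ of the map induced by $\phi$ on $\mathcal{O}_K/\pi^n\mathcal{O}_K$; $\mathbb{X}_\sigma\subset\mathcal{O}_K$ is the set of points whose class modulo $\pi^n$ belongs to $\sigma$. For $x\in\mathbb{X}_\sigma$ put $a_n(x)=(\phi^{\circ k})'(x)$ and $b_n(x)=(\phi^{\circ k}(x)-x)/\pi^n\in\mathcal{O}_K$. The cycle $\sigma$ grows if $a_n\equiv1$ and $b_n\not\equiv0 \pmod \pi$ on $\mathbb{X}_\sigma$, and splits if $a_n\equiv1$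 and $b_n\equiv0\pmod\pi$ on $\mathbb{X}_\sigma$. The descendants of $\sigma$ in generation $m\ge 0$ are the cycles $\tau$ at level $n+m$ with $\mathbb{X}_\tau\subset\mathbb{X}_\sigma$. A set $S\subset\mathcal{O}_K$ (or the subsystem $\phi:S\to S$) is of type $(k,e)$ if $S=\mathbb{X}_\sigma$ for some growing $k$-cycle $\sigma$ at some level $n\ge1$ such that every descendant in generation $m$ grows if $e\mid m$ and splits if $e\nmid m$ (that is: the lifts of $\sigma$ split $e-1$ times, then all descendants grow, then their lifts split $e-1$ times, and so on). The attracting basin of a nonempty set $Y$ is the set of points $x$ for which the distance from $\phi^{\circ m}(x)$ to $Y$ tends to $0$ as $m\to\infty$. A minimal subsystem is a nonempty closed set $M\subset\mathcal{O}_K$ with $\phi(M)\subset M$ in which every forward orbit of a point of $M$ is dense. Theorem. Let $\phi\in\mathcal{O}_K\langle x\rangle$ be such that $\phi^{\circ n}$ is not the identity for any $n\geq1$. Then $$\mathcal{O}_K=A\sqcup B\sqcup C,$$ where $A$, the set of all periodic points of $\phi$, is finite, and $B=\bigsqcup_i B_i$ is a disjoint union of a finite (possibly empty) or countable family of clopen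 invariant sets $B_i$, each of which is a finite union of balls and such that each subsystem $\phi:B_i\to B_i$ is of type $(k\ell p^n,e)$ for some positive integers $1\le k\le p^f$, $\ell\mid p^f-1$, and some $n\in\mathbb{N}=\{0,1,2,\dots\}$; moreover $B$ contains every clopen invariant set with these properties, so that it is the union of all of them. Each point of $C$ lies in the attracting basin of a periodic orbit or of one of the subsystems $B_i$. If moreover $K\neq\mathbb{Q}_p$, then each $B_i$ contains uncountably many minimal subsystems of $\phi$; and $\phi$ has uncountably many minimal subsystems as soon as it has a minimal subsystem with infinitely many points. -/

import Mathlib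

open Filter Topology
open scoped NormedField Valued PowerSeries

namespace PadicDynamics

section Field

variable (p : ℕ) (K : Type*) [NormedField K]

/-- `e` is the ramification index: `v_p(K^*) = (1/e) ℤ`, where `v_p(x) = - log_p |x|`. -/
def IsRamificationIndex (e : ℕ) : Prop :=
  0 < e ∧ {r : ℝ | ∃ x : K, x ≠ 0 ∧ -Real.logb p ‖x‖ = r} = {r : ℝ | ∃ m : ℤ, (m : ℝ) / e = r}

end Field

variable {K : Type*} [NormedField K] [IsUltrametricDist K]

/-- `π` is a uniformizer: `v_p(π) = 1/e`, where `e` is the ramification index. -/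
def IsUniformizer (p e : ℕ) (π : 𝒪[K]) : Prop :=
  π ≠ 0 ∧ -Real.logb p ‖(π : K)‖ = 1 / e

/-- Membership in `𝒪_K⟨x⟩`: a power series over `𝒪_K` whose coefficients tend to `0`. -/
def IsConvergent (φ : 𝒪[K]⟦X⟧) : Prop :=
  Tendsto (fun i : ℕ => PowerSeries.coeff i φ) atTop (𝓝 0)

/-- The self-map `x ↦ ∑ aᵢ xⁱ` of `𝒪_K` given by a power series. -/
noncomputable def toMap (φ : 𝒪[K]⟦X⟧) (x : 𝒪[K]) : 𝒪[K] :=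
  ∑' i : ℕ, PowerSeries.coeff i φ * x ^ i

/-- `σ = (σ 0, …, σ (k - 1))` is a cycle of length `k` of the map induced by `φ` on `𝒪_K / πⁿ 𝒪_K`:
the `k` classes are distinct, and `φ` maps the class `σ i` into the class `σ (i + 1)`, where `i`
is read modulo `k`. -/
def IsCycle (φ : 𝒪[K]⟦X⟧) (π : 𝒪[K]) (n k : ℕ)
    (σ : ZMod k → 𝒪[K] ⧸ Ideal.span {π ^ n}) : Prop :=
  0 < k ∧ Function.Injective σ ∧
    ∀ (i : ZMod k) (x : 𝒪[K]), Ideal.Quotient.mk (Ideal.span {π ^ n}) x = σ i →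
      Ideal.Quotient.mk (Ideal.span {π ^ n}) (toMap φ x) = σ (i + 1)

/-- The set `𝕏_σ` of all points of `𝒪_K` whose class modulo `πⁿ` belongs to `σ`. -/
def cycleSet (π : 𝒪[K]) (n k : ℕ) (σ : ZMod k → 𝒪[K] ⧸ Ideal.span {π ^ n}) : Set 𝒪[K] :=
  {x | Ideal.Quotient.mk (Ideal.span {π ^ n}) x ∈ Set.range σ}

/-- `∏_{j < k} φ'(φ^{∘ j}(x))`, the derivative at `x` of the `k`-th iterate of `φ`. -/
noncomputable def multiplier (φ : 𝒪[K]⟦X⟧) (k : ℕ) (x : 𝒪[K]) : 𝒪[K] :=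
  ∏ j ∈ Finset.range k, toMap (PowerSeries.derivative 𝒪[K] φ) ((toMap φ)^[j] x)

/-- The `k`-cycle `σ` at level `n` grows: `a_n ≡ 1` and `b_n ≢ 0` modulo `π` on `𝕏_σ`, where `a_n`
is the multiplier and `b_n(x) = (φ^{∘ k}(x) - x) / πⁿ`. -/
def Grows (φ : 𝒪[K]⟦X⟧) (π : 𝒪[K]) (n k : ℕ)
    (σ : ZMod k → 𝒪[K] ⧸ Ideal.span {π ^ n}) : Prop :=
  ∀ x ∈ cycleSet π n k σ, π ∣ multiplier φ k x - 1 ∧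
    ∃ b : 𝒪[K], (toMap φ)^[k] x - x = π ^ n * b ∧ ¬ π ∣ b

/-- The `k`-cycle `σ` at level `n` splits: `a_n ≡ 1` and `b_n ≡ 0` modulo `π` on `𝕏_σ`. -/
def Splits (φ : 𝒪[K]⟦X⟧) (π : 𝒪[K]) (n k : ℕ)
    (σ : ZMod k → 𝒪[K] ⧸ Ideal.span {π ^ n}) : Prop :=
  ∀ x ∈ cycleSet π n k σ, π ∣ multiplier φ k x - 1 ∧
    ∃ b : 𝒪[K], (toMap φ)^[k] x - x = π ^ n * b ∧ π ∣ b

/-- `φ : S → S` is of type `(k, e)`: `S = 𝕏_σ` for a growing `k`-cycle `σ` at some level `n ≥ 1`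
whose lifts split `e - 1` times, then all descendants grow, then the lifts of these split `e - 1`
times, then all descendants grow, and so on for ever. The descendants of `σ` in generation `m` are
the cycles at level `n + m` that lie over `σ`. -/
def HasType (φ : 𝒪[K]⟦X⟧) (π : 𝒪[K]) (k e : ℕ) (S : Set 𝒪[K]) : Prop :=
  ∃ (n : ℕ) (σ : ZMod k → 𝒪[K] ⧸ Ideal.span {π ^ n}),
    1 ≤ n ∧ IsCycle φ π n k σ ∧ S = cycleSet π n k σ ∧ Grows φ π n k σ ∧
    ∀ (m k' : ℕ) (τ : ZMod k' → 𝒪[K] ⧸ Ideal.span {π ^ (n + m)}),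
      IsCycle φ π (n + m) k' τ → cycleSet π (n + m) k' τ ⊆ cycleSet π n k σ →
        (e ∣ m → Grows φ π (n + m) k' τ) ∧ (¬ e ∣ m → Splits φ π (n + m) k' τ)

/-- `S` is a finite union of closed balls of positive radius in `𝒪_K`. -/
def IsFiniteUnionOfBalls (S : Set 𝒪[K]) : Prop :=
  ∃ F : Set (𝒪[K] × ℝ), F.Finite ∧ (∀ c ∈ F, 0 < c.2) ∧ S = ⋃ c ∈ F, Metric.closedBall c.1 c.2

/-- `S` is a clopen invariant set, a finite union of balls, on which `φ` is of type `(k ℓ pⁿ, e)`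
with `1 ≤ k ≤ p ^ f`, `ℓ ∣ p ^ f - 1` and `n ∈ ℕ`. -/
def IsComponent (p e f : ℕ) (φ : 𝒪[K]⟦X⟧) (π : 𝒪[K]) (S : Set 𝒪[K]) : Prop :=
  IsClopen S ∧ Set.MapsTo (toMap φ) S S ∧ IsFiniteUnionOfBalls S ∧
    ∃ k l n : ℕ, 1 ≤ k ∧ k ≤ p ^ f ∧ 1 ≤ l ∧ l ∣ p ^ f - 1 ∧ HasType φ π (k * l * p ^ n) e S

section Topological

variable {X : Type*} [PseudoMetricSpace X]

/-- The forward orbit of `x`. -/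
def orbit (T : X → X) (x : X) : Set X := Set.range fun j : ℕ => T^[j] x

/-- The attracting basin of `Y`: the points whose iterates converge to `Y`. -/
def basin (T : X → X) (Y : Set X) : Set X :=
  {x | Tendsto (fun m : ℕ => Metric.infDist (T^[m] x) Y) atTop (𝓝 0)}

/-- `M` is a minimal subsystem: a nonempty closed invariant set in which every orbit is dense. -/
def IsMinimalSubsystem (T : X → X) (M : Set X) : Prop :=
  M.Nonempty ∧ IsClosed M ∧ Set.MapsTo T M M ∧ ∀ x ∈ M, M ⊆ closure (orbit T x)

end Topological

end PadicDynamics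

/-!
Write `T` for the map given by `φ` and call the length of the cycle modulo `πⁿ` through `x` the
period of `x` at level `n`. The first-order Taylor expansion of the iterates of `T`, with integral
quadratic remainder (`HasTaylor.taylor_iterate`), shows that the return map of a cycle at level `n`
acts on the classes at level `n + 1` over a given one as `h ↦ b + a h`, where `a` is the multiplier
of the cycle (`HasTaylor.exists_iterate_mul_eq`). So the period stays the same, or is multiplied by
the order of `a` in the residue field, after which `a ≡ 1`, or, if `a ≡ 1` already, is multiplied by
`p`. Hence the periods have the form `k ℓ pˢ` (`HasTaylor.period_eq`).

Let `x` be periodic at all levels. If its periods are bounded, then `x` is periodic. If not, then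
each growth raises the multiplier to the power `p`, so that the multipliers tend to `1`
(`HasTaylor.eventually_dvd_iterDeriv_sub_one`). Once `a ≡ 1` modulo `π ^ (e + 1)`, the return map
`g` is close to a translation: `g^j(x) - x` equals `j (g(x) - x)` up to a factor congruent to `1`
(`HasTaylor.exists_iterate_mul_sub_eq`). Since `p` has order `e`, a growing cycle at such a level is
followed by exactly one growth in every `e` generations, and the points visited by it form a set of
type `(k ℓ pˢ, e)` (`HasTaylor.exists_hasGrowthPattern`).

An arbitrary orbit accumulates at some point by compactness; this point is periodic at all levels,
and the orbit is attracted by its periodic orbit or enters its component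
(`IsConvergent.mem_basin`). Components that meet are nested, and the family in the theorem
consists of the maximal ones. If there were infinitely many periodic points, then at an accumulation
point of them the estimate for `g^j(x) - x` would give infinitely many fixed points of one iterate
near it, against the identity principle for convergent power series
(`IsConvergent.finite_periodicPts`).

The orbit closures in a component are minimal subsystems and cover it. If there were only countably
many, then by Baire's theorem one of them would contain a ball; then at all high levels a whole
class would be covered by a single cycle. This is impossible at a split, and if there are no splits
(`e = 1`) then it forces the residue field to be the prime field, whence `K = ℚ_p`
(`HasTaylor.not_countable_minimal`).
-/

namespace PadicDynamics

/-! ### Convergent power series over the ring of integers -/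

lemma tsum_mul_tsum_eq_of_nonarchimedean {R : Type*} [Ring R] [UniformSpace R]
    [IsUniformAddGroup R] [NonarchimedeanRing R] [T2Space R] {a b : ℕ → R} (ha : Summable a)
    (hb : Summable b) :
    (∑' i, a i) * ∑' i, b i = ∑' n, ∑ q ∈ Finset.HasAntidiagonal.antidiagonal n, a q.1 * b q.2 := by
  have : T3Space R := inferInstance
  exact ha.tsum_mul_tsum_eq_tsum_sum_antidiagonal hb (ha.mul_of_nonarchimedean hb)

section PowerSeries

variable {K : Type*} [NormedField K] [IsUltrametricDist K]

lemma mem_integer_iff {x : K} : x ∈ 𝒪[K] ↔ ‖x‖ ≤ 1 := by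
  rw [Valuation.mem_integer_iff]
  exact NNReal.coe_le_coe.symm

lemma norm_integer_le_one (x : 𝒪[K]) : ‖x‖ ≤ 1 := mem_integer_iff.1 x.2

lemma norm_integer_mul_le (x y : 𝒪[K]) : ‖x * y‖ ≤ ‖x‖ :=
  (norm_mul_le x y).trans (mul_le_of_le_one_right (norm_nonneg _) (norm_integer_le_one y))

instance : NonarchimedeanRing 𝒪[K] :=
  { (inferInstance : NonarchimedeanAddGroup 𝒪[K]) with }

lemma tendsto_cofinite_mul_of_tendsto {ι : Type*} {a : ι → 𝒪[K]} (ha : Tendsto a cofinite (𝓝 0))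
    (y : ι → 𝒪[K]) : Tendsto (fun i => a i * y i) cofinite (𝓝 0) :=
  squeeze_zero_norm (fun i => norm_integer_mul_le (a i) (y i))
    (tendsto_zero_iff_norm_tendsto_zero.1 ha)

lemma IsConvergent.tendsto_cofinite {φ : 𝒪[K]⟦X⟧} (hφ : IsConvergent φ) :
    Tendsto (fun i : ℕ => PowerSeries.coeff i φ) cofinite (𝓝 0) := by
  rw [Nat.cofinite_eq_atTop]; exact hφ

lemma isConvergent_iff_isRestricted {φ : 𝒪[K]⟦X⟧} :
    IsConvergent φ ↔ PowerSeries.IsRestricted 1 φ := by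
  rw [PowerSeries.isRestricted_iff', IsConvergent, tendsto_zero_iff_norm_tendsto_zero]
  simp

lemma IsConvergent.mul {φ ψ : 𝒪[K]⟦X⟧} (hφ : IsConvergent φ) (hψ : IsConvergent ψ) :
    IsConvergent (φ * ψ) :=
  isConvergent_iff_isRestricted.2 (PowerSeries.isRestricted.mul 1
    (isConvergent_iff_isRestricted.1 hφ) (isConvergent_iff_isRestricted.1 hψ))

lemma IsConvergent.add {φ ψ : 𝒪[K]⟦X⟧} (hφ : IsConvergent φ) (hψ : IsConvergent ψ) :
    IsConvergent (φ + ψ) :=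
  isConvergent_iff_isRestricted.2 (PowerSeries.isRestricted.add 1
    (isConvergent_iff_isRestricted.1 hφ) (isConvergent_iff_isRestricted.1 hψ))

lemma isConvergent_monomial (n : ℕ) (a : 𝒪[K]) : IsConvergent (PowerSeries.monomial n a) :=
  isConvergent_iff_isRestricted.2 (PowerSeries.isRestricted_monomial 1 n a)

lemma IsConvergent.pow {φ : 𝒪[K]⟦X⟧} (hφ : IsConvergent φ) (n : ℕ) : IsConvergent (φ ^ n) := by
  induction n with
  | zero =>
    have h := isConvergent_monomial (K := K) 0 1
    rwa [PowerSeries.monomial_zero_eq_C_apply, map_one, ← pow_zero φ] at h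
  | succ n ih => rw [pow_succ]; exact ih.mul hφ

lemma IsConvergent.derivative {φ : 𝒪[K]⟦X⟧} (hφ : IsConvergent φ) :
    IsConvergent (PowerSeries.derivative 𝒪[K] φ) := by
  unfold IsConvergent
  simp only [PowerSeries.coeff_derivative]
  have := tendsto_cofinite_mul_of_tendsto
    (a := fun i : ℕ => PowerSeries.coeff (i + 1) φ)
    (by rw [Nat.cofinite_eq_atTop]; exact hφ.comp (tendsto_add_atTop_nat 1))
    (fun i => (i : 𝒪[K]) + 1)
  rwa [Nat.cofinite_eq_atTop] at this

lemma toMap_monomial (n : ℕ) (a x : 𝒪[K]) : toMap (PowerSeries.monomial n a) x = a * x ^ n := by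
  rw [toMap, tsum_eq_single n]
  · simp
  · intro i hi
    simp [PowerSeries.coeff_monomial, hi]

variable [CompleteSpace 𝒪[K]]

lemma summable_mul_of_tendsto {ι : Type*} {a : ι → 𝒪[K]} (ha : Tendsto a cofinite (𝓝 0))
    (y : ι → 𝒪[K]) : Summable fun i => a i * y i :=
  NonarchimedeanAddGroup.summable_of_tendsto_cofinite_zero (tendsto_cofinite_mul_of_tendsto ha y)

lemma IsConvergent.summable {φ : 𝒪[K]⟦X⟧} (hφ : IsConvergent φ) (x : 𝒪[K]) :
    Summable fun i : ℕ => PowerSeries.coeff i φ * x ^ i :=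
  summable_mul_of_tendsto hφ.tendsto_cofinite _

/-- The first-order Taylor expansion, with an integral quadratic remainder. -/
lemma IsConvergent.exists_toMap_add {φ : 𝒪[K]⟦X⟧} (hφ : IsConvergent φ) (x h : 𝒪[K]) :
    ∃ r, toMap φ (x + h) = toMap φ x + toMap (PowerSeries.derivative 𝒪[K] φ) x * h + h ^ 2 * r := by
  have hs := fun y : ℕ → 𝒪[K] => summable_mul_of_tendsto hφ.tendsto_cofinite y
  have hder : toMap (PowerSeries.derivative 𝒪[K] φ) x
      = ∑' i : ℕ, PowerSeries.coeff i φ * (i * x ^ (i - 1)) := by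
    rw [(hs _).tsum_eq_zero_add, toMap]
    simp [PowerSeries.coeff_derivative, mul_assoc]
  refine ⟨∑' i : ℕ, PowerSeries.coeff i φ * (Polynomial.powAddExpansion x h i).1, ?_⟩
  rw [hder, toMap, toMap, ← (hs _).tsum_mul_right, ← (hs _).tsum_mul_left,
    ← (hφ.summable x).tsum_add ((hs _).mul_right h),
    ← ((hφ.summable x).add ((hs _).mul_right h)).tsum_add ((hs _).mul_left _)]
  refine tsum_congr fun i => ?_
  calc PowerSeries.coeff i φ * (x + h) ^ i = PowerSeries.coeff i φ * _ :=
        congrArg _ (Polynomial.powAddExpansion x h i).2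
    _ = _ := by ring

lemma IsConvergent.sub_dvd {φ : 𝒪[K]⟦X⟧} (hφ : IsConvergent φ) (x y : 𝒪[K]) :
    x - y ∣ toMap φ x - toMap φ y := by
  obtain ⟨r, hr⟩ := hφ.exists_toMap_add y (x - y)
  rw [add_sub_cancel] at hr
  exact ⟨toMap (PowerSeries.derivative 𝒪[K] φ) y + (x - y) * r, by rw [hr]; ring⟩

lemma toMap_add {φ ψ : 𝒪[K]⟦X⟧} (hφ : IsConvergent φ) (hψ : IsConvergent ψ) (x : 𝒪[K]) :
    toMap (φ + ψ) x = toMap φ x + toMap ψ x := by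
  rw [toMap, toMap, toMap, ← (hφ.summable x).tsum_add (hψ.summable x)]
  simp [add_mul]

lemma toMap_mul {φ ψ : 𝒪[K]⟦X⟧} (hφ : IsConvergent φ) (hψ : IsConvergent ψ) (x : 𝒪[K]) :
    toMap (φ * ψ) x = toMap φ x * toMap ψ x := by
  rw [toMap, toMap, toMap, tsum_mul_tsum_eq_of_nonarchimedean (hφ.summable x) (hψ.summable x)]
  refine tsum_congr fun n => ?_
  rw [PowerSeries.coeff_mul, Finset.sum_mul]
  refine Finset.sum_congr rfl fun i hi => ?_
  rw [← Finset.HasAntidiagonal.mem_antidiagonal.1 hi, pow_add]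
  ring

lemma toMap_pow {φ : 𝒪[K]⟦X⟧} (hφ : IsConvergent φ) (n : ℕ) (x : 𝒪[K]) :
    toMap (φ ^ n) x = toMap φ x ^ n := by
  induction n with
  | zero =>
    have h := toMap_monomial 0 1 x
    rwa [PowerSeries.monomial_zero_eq_C_apply, map_one, one_mul, pow_zero, ← pow_zero φ,
      ← pow_zero (toMap φ x)] at h
  | succ n ih => rw [pow_succ, toMap_mul (hφ.pow n) hφ, ih, pow_succ]

/-- Convergent power series are closed under composition: the coefficients of the composite are the
sums `∑ᵢ aᵢ [ψⁱ]ⱼ`, and the double series may be rearranged because its terms tend to `0`. -/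
lemma IsConvergent.exists_comp {φ ψ : 𝒪[K]⟦X⟧} (hφ : IsConvergent φ) (hψ : IsConvergent ψ) :
    ∃ χ : 𝒪[K]⟦X⟧, IsConvergent χ ∧ ∀ x, toMap χ x = toMap φ (toMap ψ x) := by
  set c : ℕ × ℕ → 𝒪[K] := fun q => PowerSeries.coeff q.1 φ * PowerSeries.coeff q.2 (ψ ^ q.1) with hc
  have hc0 : Tendsto c cofinite (𝓝 0) := by
    rw [Metric.tendsto_nhds]
    intro ε hε
    have h1 := (Metric.tendsto_nhds.1 hφ.tendsto_cofinite ε hε)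
    have h2 := fun i => (Metric.tendsto_nhds.1 (hψ.pow i).tendsto_cofinite ε hε)
    rw [eventually_cofinite] at h1 ⊢
    simp only [eventually_cofinite] at h2
    refine (h1.biUnion fun i _ => (Set.finite_singleton i).prod (h2 i)).subset ?_
    rintro ⟨i, j⟩ hij
    simp only [dist_zero_right, not_lt, Set.mem_ofPred_eq, hc] at hij
    simp only [Set.mem_iUnion, dist_zero_right, not_lt, Set.mem_ofPred_eq, Set.mem_prod,
      Set.mem_singleton_iff]
    refine ⟨i, hij.trans (norm_integer_mul_le _ _), rfl, ?_⟩
    rw [mul_comm] at hij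
    exact hij.trans (norm_integer_mul_le _ _)
  have hsum : ∀ j, Summable fun i => c (i, j) := fun j =>
    summable_mul_of_tendsto hφ.tendsto_cofinite _
  refine ⟨PowerSeries.mk fun j => ∑' i, c (i, j), ?_, fun x => ?_⟩
  · rw [IsConvergent, Metric.tendsto_atTop']
    intro ε hε
    have h := Metric.tendsto_nhds.1 hc0 (ε / 2) (half_pos hε)
    rw [eventually_cofinite] at h
    obtain ⟨N, hN⟩ := (h.image Prod.snd).bddAbove
    refine ⟨N, fun j hj => ?_⟩
    rw [PowerSeries.coeff_mk, dist_zero_right]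
    refine lt_of_le_of_lt ?_ (half_lt_self hε)
    refine IsUltrametricDist.norm_tsum_le_of_forall_le_of_nonneg (half_pos hε).le fun i => ?_
    by_contra hcon
    refine hj.not_ge (hN ⟨(i, j), ?_, rfl⟩)
    simpa using (not_le.1 hcon).le
  · have hs : Summable fun q : ℕ × ℕ => c q * x ^ q.2 := summable_mul_of_tendsto hc0 _
    calc toMap (PowerSeries.mk fun j => ∑' i, c (i, j)) x
        = ∑' j, ∑' i, c (i, j) * x ^ j := by
          rw [toMap]
          refine tsum_congr fun j => ?_
          rw [PowerSeries.coeff_mk, (hsum j).tsum_mul_right]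
      _ = ∑' i, ∑' j, c (i, j) * x ^ j :=
          Summable.tsum_comm (f := fun i j => c (i, j) * x ^ j) hs
      _ = toMap φ (toMap ψ x) := by
          rw [toMap]
          refine tsum_congr fun i => ?_
          rw [← toMap_pow hψ, toMap, ← ((hψ.pow i).summable x).tsum_mul_left]
          exact tsum_congr fun j => by simp only [hc]; ring

lemma IsConvergent.exists_iterate {φ : 𝒪[K]⟦X⟧} (hφ : IsConvergent φ) (n : ℕ) :
    ∃ χ : 𝒪[K]⟦X⟧, IsConvergent χ ∧ toMap χ = (toMap φ)^[n] := by
  induction n with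
  | zero =>
    exact ⟨PowerSeries.monomial 1 1, isConvergent_monomial 1 1, by ext1 x; simp [toMap_monomial]⟩
  | succ n ih =>
    obtain ⟨χ, hχ, h⟩ := ih
    obtain ⟨χ', hχ', h'⟩ := hφ.exists_comp hχ
    exact ⟨χ', hχ', funext fun x => by rw [h', h, Function.iterate_succ_apply']⟩

/-- A nonzero convergent power series has no zeros in a punctured neighbourhood of `0`. -/
lemma IsConvergent.eventually_ne_zero {φ : 𝒪[K]⟦X⟧} (hφ : IsConvergent φ) (h0 : φ ≠ 0) :
    ∀ᶠ x in 𝓝[≠] 0, toMap φ x ≠ 0 := by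
  obtain ⟨ψ, hψ⟩ := PowerSeries.X_pow_order_dvd (φ := φ)
  set m := φ.order.toNat
  have hcoeff : ∀ i, PowerSeries.coeff i ψ = PowerSeries.coeff (i + m) φ := fun i => by
    rw [hψ, mul_comm, PowerSeries.coeff_mul_X_pow]
  have hψc : IsConvergent ψ := by
    unfold IsConvergent
    simp only [hcoeff]
    exact hφ.comp (tendsto_add_atTop_nat m)
  have hc : PowerSeries.coeff 0 ψ ≠ 0 := by
    rw [hcoeff, zero_add]
    exact PowerSeries.coeff_order h0
  have hval : ∀ x, toMap φ x = x ^ m * toMap ψ x := fun x => by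
    have hX : (PowerSeries.X : 𝒪[K]⟦X⟧) ^ m = PowerSeries.monomial m 1 := PowerSeries.X_pow_eq m
    rw [hψ, hX, toMap_mul (isConvergent_monomial m 1) hψc, toMap_monomial, one_mul]
  have hψ0 : toMap ψ 0 = PowerSeries.coeff 0 ψ := by
    rw [toMap, tsum_eq_single 0]
    · simp
    · intro i hi
      simp [hi]
  have hpos : 0 < ‖PowerSeries.coeff 0 ψ‖ := norm_pos_iff.2 hc
  filter_upwards [self_mem_nhdsWithin, mem_nhdsWithin_of_mem_nhds (Metric.ball_mem_nhds 0 hpos)]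
    with x hx hxb hzero
  rw [hval, mul_eq_zero] at hzero
  rcases hzero with hzero | hzero
  · exact hx (eq_zero_of_pow_eq_zero hzero)
  · obtain ⟨c, hc'⟩ := hψc.sub_dvd 0 x
    rw [hψ0, hzero, sub_zero, zero_sub] at hc'
    have := norm_integer_mul_le (-x) c
    rw [← hc', norm_neg] at this
    rw [mem_ball_zero_iff] at hxb
    exact hxb.not_ge this

/-- Identity principle: the fixed points of an iterate that is not the identity are isolated. -/
lemma IsConvergent.eventually_iterate_ne {φ : 𝒪[K]⟦X⟧} (hφ : IsConvergent φ) {n : ℕ}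
    (hn : (toMap φ)^[n] ≠ id) (x : 𝒪[K]) : ∀ᶠ y in 𝓝[≠] x, (toMap φ)^[n] y ≠ y := by
  obtain ⟨χ, hχ, h⟩ := hφ.exists_iterate n
  have h1 := hχ.add (isConvergent_monomial 1 (-1))
  obtain ⟨η, hη, hη'⟩ := h1.exists_comp ((isConvergent_monomial 0 x).add (isConvergent_monomial 1 1))
  have hval : ∀ t, toMap η t = (toMap φ)^[n] (x + t) - (x + t) := fun t => by
    rw [hη', toMap_add hχ (isConvergent_monomial 1 (-1)), h,
      toMap_add (isConvergent_monomial 0 x) (isConvergent_monomial 1 1)]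
    simp only [toMap_monomial, pow_zero, pow_one, mul_one, one_mul, neg_mul, sub_eq_add_neg]
  have hη0 : η ≠ 0 := by
    rintro rfl
    refine hn (funext fun y => ?_)
    have := hval (y - x)
    rw [add_sub_cancel] at this
    rw [id, ← sub_eq_zero, ← this]
    simp [toMap]
  have key := hη.eventually_ne_zero hη0
  have ht : Tendsto (fun y => y - x) (𝓝[≠] x) (𝓝[≠] 0) := by
    refine tendsto_nhdsWithin_of_tendsto_nhds_of_eventually_within _ ?_ ?_
    · have : Tendsto (fun y => y - x) (𝓝 x) (𝓝 (x - x)) := tendsto_id.sub_const x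
      rw [sub_self] at this
      exact this.mono_left nhdsWithin_le_nhds
    · filter_upwards [self_mem_nhdsWithin] with y hy
      exact sub_ne_zero.2 hy
  filter_upwards [ht.eventually key] with y hy heq
  refine hy ?_
  rw [hval, add_sub_cancel, heq, sub_self]

end PowerSeries

/-! ### Periods and multipliers modulo powers of a prime element -/

section Dynamics

variable {R : Type*} [CommRing R] {T D : R → R}

lemma dvd_sub_trans {d a b c : R} (h₁ : d ∣ a - b) (h₂ : d ∣ b - c) : d ∣ a - c := by
  simpa using dvd_add h₁ h₂

/-- `T` has the derivative `D` with quadratic remainder, both over `R`. This is all that the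
argument uses about maps given by convergent power series, apart from their identity principle. -/
structure HasTaylor (T D : R → R) : Prop where
  taylor : ∀ x h, ∃ r, T (x + h) = T x + D x * h + h ^ 2 * r
  sub_dvd_deriv : ∀ x y, x - y ∣ D x - D y

/-- The derivative of `T^[k]` at `x`, by the chain rule. -/
def iterDeriv (T D : R → R) (k : ℕ) (x : R) : R := ∏ j ∈ Finset.range k, D (T^[j] x)

lemma iterDeriv_add (T D : R → R) (k l : ℕ) (x : R) :
    iterDeriv T D (k + l) x = iterDeriv T D k x * iterDeriv T D l (T^[k] x) := by
  rw [iterDeriv, Finset.prod_range_add]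
  simp only [iterDeriv, ← Function.iterate_add_apply, add_comm]

lemma iterDeriv_one (T D : R → R) (x : R) : iterDeriv T D 1 x = D x := by
  simp [iterDeriv]

namespace HasTaylor

variable (hT : HasTaylor T D)
include hT

lemma sub_dvd (x y : R) : x - y ∣ T x - T y := by
  obtain ⟨r, hr⟩ := hT.taylor y (x - y)
  rw [add_sub_cancel] at hr
  exact ⟨D y + (x - y) * r, by rw [hr]; ring⟩

lemma sub_dvd_iterate (k : ℕ) (x y : R) : x - y ∣ T^[k] x - T^[k] y := by
  induction k with
  | zero => simp
  | succ k ih =>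
    rw [Function.iterate_succ_apply', Function.iterate_succ_apply']
    exact ih.trans (hT.sub_dvd _ _)

lemma dvd_iterate {d x y : R} (h : d ∣ x - y) (k : ℕ) : d ∣ T^[k] x - T^[k] y :=
  h.trans (hT.sub_dvd_iterate k x y)

lemma taylor_iterate (k : ℕ) (x u : R) :
    ∃ r, T^[k] (x + u) = T^[k] x + iterDeriv T D k x * u + u ^ 2 * r := by
  induction k with
  | zero => exact ⟨0, by simp [iterDeriv]⟩
  | succ k ih =>
    obtain ⟨r, hr⟩ := ih
    obtain ⟨s, hs⟩ := hT.taylor (T^[k] x) (iterDeriv T D k x * u + u ^ 2 * r)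
    refine ⟨D (T^[k] x) * r + (iterDeriv T D k x + u * r) ^ 2 * s, ?_⟩
    rw [Function.iterate_succ_apply', Function.iterate_succ_apply', hr, add_assoc, hs,
      iterDeriv_add, iterDeriv_one]
    ring

lemma sub_dvd_iterDeriv (k : ℕ) (x y : R) : x - y ∣ iterDeriv T D k x - iterDeriv T D k y := by
  induction k with
  | zero => simp [iterDeriv]
  | succ k ih =>
    obtain ⟨c, hc⟩ := ih
    obtain ⟨c', hc'⟩ := (hT.sub_dvd_iterate k x y).trans (hT.sub_dvd_deriv (T^[k] x) (T^[k] y))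
    rw [iterDeriv_add, iterDeriv_add, iterDeriv_one, iterDeriv_one]
    refine ⟨c * D (T^[k] x) + iterDeriv T D k y * c', ?_⟩
    linear_combination D (T^[k] x) * hc + iterDeriv T D k y * hc'

lemma dvd_iterate_mul {d x : R} {k : ℕ} (h : d ∣ T^[k] x - x) (j : ℕ) :
    d ∣ T^[k * j] x - x := by
  induction j with
  | zero => simp
  | succ j ih =>
    rw [mul_add_one, Function.iterate_add_apply]
    exact dvd_sub_trans (hT.dvd_iterate h _) ih

lemma dvd_iterDeriv_mul {d x : R} {k : ℕ} (h : d ∣ T^[k] x - x) (j : ℕ) :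
    d ∣ iterDeriv T D (k * j) x - iterDeriv T D k x ^ j := by
  induction j with
  | zero => simp [iterDeriv]
  | succ j ih =>
    obtain ⟨c, hc⟩ := ih
    obtain ⟨c', hc'⟩ := (hT.dvd_iterate_mul h j).trans (hT.sub_dvd_iterDeriv k _ _)
    rw [mul_add_one, iterDeriv_add, pow_succ]
    refine ⟨c * iterDeriv T D k (T^[k * j] x) + iterDeriv T D k x ^ j * c', ?_⟩
    linear_combination iterDeriv T D k (T^[k * j] x) * hc + iterDeriv T D k x ^ j * hc'

/-- The multiplier of a cycle modulo `d` does not depend on the starting point. -/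
lemma dvd_iterDeriv_iterate {d x : R} {k : ℕ} (h : d ∣ T^[k] x - x) (t : ℕ) :
    d ∣ iterDeriv T D k (T^[t] x) - iterDeriv T D k x := by
  induction t generalizing x with
  | zero => simp
  | succ t ih =>
    rw [Function.iterate_succ_apply]
    refine dvd_sub_trans (ih (x := T x) ?_) ?_
    · rw [← Function.iterate_succ_apply, Function.iterate_succ_apply']
      exact h.trans (hT.sub_dvd _ _)
    · obtain _ | k := k
      · simp [iterDeriv]
      · rw [iterDeriv_add, add_comm k 1, iterDeriv_add, iterDeriv_one, iterDeriv_one, mul_comm,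
          Function.iterate_one, ← sub_mul, ← Function.iterate_succ_apply]
        exact (h.trans (hT.sub_dvd_deriv _ _)).mul_right _

lemma dvd_iterDeriv_mul_sub_one {d x : R} {k : ℕ} (h : d ∣ T^[k] x - x)
    (h1 : d ∣ iterDeriv T D k x - 1) (j : ℕ) : d ∣ iterDeriv T D (k * j) x - 1 :=
  dvd_sub_trans (hT.dvd_iterDeriv_mul h j) (h1.trans (sub_one_dvd_pow_sub_one _ _))

end HasTaylor

/-- The length of the cycle of `T` modulo `d` through the class of `x`, and `0` if this class is not
periodic. -/
noncomputable def period (T : R → R) (d x : R) : ℕ := sInf {j | 0 < j ∧ d ∣ T^[j] x - x}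

lemma dvd_iterate_period (T : R → R) (d x : R) : d ∣ T^[period T d x] x - x := by
  rcases Set.eq_empty_or_nonempty {j | 0 < j ∧ d ∣ T^[j] x - x} with h | h
  · rw [period, h, Nat.sInf_empty]
    simp
  · exact (Nat.sInf_mem h).2

lemma period_pos {d x : R} {j : ℕ} (hj : 0 < j) (h : d ∣ T^[j] x - x) : 0 < period T d x :=
  (Nat.sInf_mem (s := {j | 0 < j ∧ d ∣ T^[j] x - x}) ⟨j, hj, h⟩).1

namespace HasTaylor

variable (hT : HasTaylor T D)
include hT

lemma dvd_iterate_iff {d x : R} {j : ℕ} : d ∣ T^[j] x - x ↔ period T d x ∣ j := by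
  refine ⟨fun h => ?_, ?_⟩
  · rcases Nat.eq_zero_or_pos j with rfl | hj
    · exact dvd_zero _
    have hr : d ∣ T^[j % period T d x] x - x := by
      have h1 := hT.dvd_iterate (hT.dvd_iterate_mul (dvd_iterate_period T d x)
        (j / period T d x)) (j % period T d x)
      rw [← Function.iterate_add_apply, Nat.mod_add_div, dvd_sub_comm] at h1
      exact dvd_sub_trans h1 h
    by_contra hcon
    have hpos : 0 < j % period T d x := Nat.pos_of_ne_zero fun h0 => hcon (Nat.dvd_of_mod_eq_zero h0)
    exact (Nat.sInf_le (s := {j | 0 < j ∧ d ∣ T^[j] x - x}) ⟨hpos, hr⟩).not_gt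
      (Nat.mod_lt _ (period_pos hj h))
  · rintro ⟨i, rfl⟩
    exact hT.dvd_iterate_mul (dvd_iterate_period T d x) i

lemma eq_of_dvd_iterate_sub {d x : R} {i j : ℕ} (hi : i < period T d x) (hj : j < period T d x)
    (h : d ∣ T^[i] x - T^[j] x) : i = j := by
  wlog hij : j ≤ i generalizing i j
  · exact (this hj hi ((dvd_sub_comm).1 h) (le_of_not_ge hij)).symm
  -- Apply the remaining steps of the cycle after the `j`-th to return to `x`.
  have h1 := hT.dvd_iterate h (period T d x - j)
  rw [← Function.iterate_add_apply, ← Function.iterate_add_apply, Nat.sub_add_cancel hj.le] at h1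
  have h2 := hT.dvd_iterate_iff.1 (dvd_sub_trans h1 (dvd_iterate_period T d x))
  rw [show period T d x - j + i = period T d x + (i - j) by omega,
    Nat.dvd_add_right dvd_rfl] at h2
  have := Nat.eq_zero_of_dvd_of_lt h2 (by omega)
  omega

lemma period_dvd_period {d d' : R} (h : d ∣ d') (x : R) : period T d x ∣ period T d' x :=
  hT.dvd_iterate_iff.1 (h.trans (dvd_iterate_period T d' x))

lemma dvd_iterDeriv_period {d d' x : R} {j : ℕ} (hj : period T d' x = period T d x * j) :
    d ∣ iterDeriv T D (period T d' x) x - iterDeriv T D (period T d x) x ^ j := by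
  rw [hj]
  exact hT.dvd_iterDeriv_mul (dvd_iterate_period _ _ _) j

lemma dvd_iterate_congr {d x y : R} (h : d ∣ x - y) {j : ℕ} (hx : d ∣ T^[j] x - x) :
    d ∣ T^[j] y - y :=
  dvd_sub_trans (dvd_sub_trans ((dvd_sub_comm).1 (hT.dvd_iterate h j)) hx) h

/-- An orbit that starts in a cycle modulo `d` returns to its starting class from everywhere. -/
lemma exists_iterate_return {d x y : R} (hx : 0 < period T d x) {i : ℕ} (h : d ∣ T^[i] x - y) :
    ∃ t, d ∣ T^[t] y - x := by
  refine ⟨period T d x * i - i, ?_⟩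
  have h1 := hT.dvd_iterate ((dvd_sub_comm).1 h) (period T d x * i - i)
  rw [← Function.iterate_add_apply, Nat.sub_add_cancel (Nat.le_mul_of_pos_left i hx)] at h1
  exact dvd_sub_trans h1 (hT.dvd_iterate_mul (dvd_iterate_period T d x) i)

/-- The return map of a cycle modulo `d` acts on the classes over `x` as the affine map
`h ↦ b + a h`; this is its `j`-th iterate at `0`. -/
lemma exists_iterate_mul_eq {π d x b : R} {k : ℕ} (hd : π ∣ d) (hb : T^[k] x = x + d * b)
    (j : ℕ) : ∃ c, T^[k * j] x = x + d * c ∧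
      π ∣ c - b * ∑ i ∈ Finset.range j, iterDeriv T D k x ^ i := by
  induction j with
  | zero => exact ⟨0, by simp, by simp⟩
  | succ j ih =>
    obtain ⟨c, hc, w, hw⟩ := ih
    obtain ⟨r, hr⟩ := hT.taylor_iterate k x (d * c)
    obtain ⟨d', rfl⟩ := hd
    refine ⟨b + iterDeriv T D k x * c + π * d' * c ^ 2 * r, ?_, ?_⟩
    · rw [mul_add_one, add_comm, Function.iterate_add_apply, hc, hr, hb]
      ring
    · rw [geom_sum_succ]
      exact ⟨iterDeriv T D k x * w + d' * c ^ 2 * r, by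
        linear_combination iterDeriv T D k x * hw⟩

/-- A map that is a translation up to an error of higher order satisfies
`T^{kj}(x) - x ≈ j (T^k(x) - x)`. -/
lemma exists_iterate_mul_sub_eq {π x : R} {e k : ℕ} (hℓ : ∀ ℓ : ℕ, ℓ.Prime → (ℓ : R) ∣ π ^ e)
    (h0 : π ^ (e + 1) ∣ T^[k] x - x) (h1 : π ^ (e + 1) ∣ iterDeriv T D k x - 1) (j : ℕ) :
    ∃ c, T^[k * j] x - x = j * (T^[k] x - x) * (1 + π * c) := by
  have main : ∀ k, π ^ (e + 1) ∣ T^[k] x - x → π ^ (e + 1) ∣ iterDeriv T D k x - 1 → ∀ j : ℕ,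
      π ^ (e + 1) * (T^[k] x - x) ∣ T^[k * j] x - x - j * (T^[k] x - x) := by
    intro k h0 h1 j
    induction j with
    | zero => simp
    | succ j ih =>
      obtain ⟨c, hc⟩ := ih
      obtain ⟨a, ha⟩ := h1
      obtain ⟨b, hb⟩ := h0
      set u := T^[k * j] x - x with hu
      obtain ⟨r, hr⟩ := hT.taylor_iterate k x u
      rw [mul_add_one, add_comm (k * j), Function.iterate_add_apply,
        show T^[k * j] x = x + u by rw [hu]; ring, hr]
      -- `u` is a multiple of `T^k(x) - x`, hence of `π ^ (e + 1)`.
      have hu1 : u = (T^[k] x - x) * (j + π ^ (e + 1) * c) := by linear_combination hc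
      have hu2 : u = π ^ (e + 1) * (b * (j + π ^ (e + 1) * c)) := by rw [hu1, hb]; ring
      refine ⟨c + (j + π ^ (e + 1) * c) * a
        + (b * (j + π ^ (e + 1) * c)) * (j + π ^ (e + 1) * c) * r, ?_⟩
      have hsq : u ^ 2 * r = π ^ (e + 1) * (b * (j + π ^ (e + 1) * c)) *
          ((T^[k] x - x) * (j + π ^ (e + 1) * c)) * r := by
        rw [sq, ← hu1, ← hu2]
      push_cast
      linear_combination hc + u * ha + π ^ (e + 1) * a * hu1 + hsq
  induction j using induction_on_primes with
  | zero => exact ⟨0, by simp⟩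
  | one => exact ⟨0, by simp⟩
  | prime_mul l j hl ih =>
    obtain ⟨c, hc⟩ := ih
    obtain ⟨c', hc'⟩ := main (k * j) (hT.dvd_iterate_mul h0 j)
      (hT.dvd_iterDeriv_mul_sub_one h0 h1 j) l
    obtain ⟨d, hd⟩ := hℓ l hl
    refine ⟨c + d * c' * (1 + π * c), ?_⟩
    rw [pow_succ, hd] at hc'
    rw [mul_comm l j, ← mul_assoc]
    push_cast
    linear_combination hc' + l * (1 + π * d * c') * hc

variable [IsDomain R]

lemma mul_dvd_iterate_mul_iff {π d x b : R} {k : ℕ} (hd0 : d ≠ 0) (hd : π ∣ d)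
    (hb : T^[k] x = x + d * b) (j : ℕ) :
    d * π ∣ T^[k * j] x - x ↔ π ∣ b * ∑ i ∈ Finset.range j, iterDeriv T D k x ^ i := by
  obtain ⟨c, hc, h⟩ := hT.exists_iterate_mul_eq hd hb j
  rw [hc, add_sub_cancel_left, mul_dvd_mul_iff_left hd0]
  exact (dvd_iff_dvd_of_dvd_sub h)

end HasTaylor

/-- The points whose class modulo `d` is visited by the orbit of `x`. If the class of `x` is
periodic, this is the union of the classes in its cycle. -/
def visited (T : R → R) (d x : R) : Set R := {y | ∃ j, d ∣ T^[j] x - y}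

lemma mem_visited_self (T : R → R) (d x : R) : x ∈ visited T d x := ⟨0, by simp⟩

lemma dvd_geom_sum_sub {π a : R} (ha : π ∣ a - 1) (j : ℕ) :
    π ∣ ∑ i ∈ Finset.range j, a ^ i - (j : R) := by
  have : ∑ i ∈ Finset.range j, a ^ i - (j : R) = ∑ i ∈ Finset.range j, (a ^ i - 1) := by
    simp
  rw [this]
  exact Finset.dvd_sum fun i _ => ha.trans (sub_one_dvd_pow_sub_one _ _)

lemma exists_pow_dvd_pow_sub_one {π a : R} {p m : ℕ} (hm : 0 < m)
    (hp : π ∣ (p : R)) (hp0 : 0 < p) (ha : π ∣ a ^ m - 1) (N : ℕ) :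
    ∃ M, 0 < M ∧ π ^ (N + 1) ∣ a ^ M - 1 := by
  induction N with
  | zero => exact ⟨m, hm, by simpa using ha⟩
  | succ N ih =>
    obtain ⟨M, hM, h⟩ := ih
    refine ⟨M * p, Nat.mul_pos hM hp0, ?_⟩
    rw [pow_mul, ← geom_sum_mul, mul_comm, pow_succ]
    exact mul_dvd_mul h ((dvd_iff_dvd_of_dvd_sub
      (dvd_geom_sum_sub ((dvd_pow_self π (by omega)).trans h) p)).2 hp)

end Dynamics

/-! ### Growth of the periods along the levels -/

section Growth

variable {R : Type*} [CommRing R] [IsDomain R] {T D : R → R} {π x : R} {p q : ℕ}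

namespace HasTaylor

variable (hT : HasTaylor T D) (hπ : Prime π)
include hT hπ

/-- When the multiplier is `1` modulo `π`, the return map acts on the classes of the next level as
a translation, whose `p`-th iterate is the identity. -/
lemma period_succ_dvd_mul (hp : π ∣ (p : R)) {n : ℕ} (hn : 1 ≤ n)
    (h1 : π ∣ iterDeriv T D (period T (π ^ n) x) x - 1) :
    period T (π ^ (n + 1)) x ∣ period T (π ^ n) x * p := by
  obtain ⟨b, hb⟩ := dvd_iterate_period T (π ^ n) x
  rw [← hT.dvd_iterate_iff, pow_succ, hT.mul_dvd_iterate_mul_iff (pow_ne_zero _ hπ.ne_zero)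
    (dvd_pow_self π (by omega)) (by rw [← hb]; ring)]
  exact Dvd.dvd.mul_left ((dvd_iff_dvd_of_dvd_sub (dvd_geom_sum_sub h1 p)).2 hp) _

lemma period_succ_eq (hp : π ∣ (p : R)) (hpp : p.Prime) {n : ℕ} (hn : 1 ≤ n)
    (h1 : π ∣ iterDeriv T D (period T (π ^ n) x) x - 1) :
    period T (π ^ (n + 1)) x = period T (π ^ n) x ∨
      period T (π ^ (n + 1)) x = period T (π ^ n) x * p := by
  obtain ⟨j, hj⟩ := hT.period_dvd_period (pow_dvd_pow π n.le_succ) x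
  have h := hT.period_succ_dvd_mul hπ hp hn h1
  rcases Nat.eq_zero_or_pos (period T (π ^ n) x) with h0 | h0
  · rw [h0, zero_mul] at hj
    exact Or.inl (by rw [h0]; exact hj)
  rw [Nat.succ_eq_add_one] at hj
  rw [hj] at h ⊢
  rcases (Nat.dvd_prime hpp).1 (Nat.dvd_of_mul_dvd_mul_left h0 h) with rfl | rfl
  · exact Or.inl (mul_one _)
  · exact Or.inr rfl

/-- When the multiplier `a` is not `1` modulo `π`, the class of `x` at the next level is either the
fixed class of the affine map `h ↦ b + a h`, or one of the others, whose period is the order of `a`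
modulo `π`. -/
lemma period_succ_of_not_dvd (hq : ∀ a : R, ¬ π ∣ a → π ∣ a ^ (q - 1) - 1) {n : ℕ} (hn : 1 ≤ n)
    (hpos : 0 < period T (π ^ (n + 1)) x)
    (h1 : ¬ π ∣ iterDeriv T D (period T (π ^ n) x) x - 1) :
    period T (π ^ (n + 1)) x = period T (π ^ n) x ∨
      ∃ j, 1 ≤ j ∧ j ∣ q - 1 ∧ period T (π ^ (n + 1)) x = period T (π ^ n) x * j ∧
        π ∣ iterDeriv T D (period T (π ^ (n + 1)) x) x - 1 := by
  obtain ⟨j, hj⟩ := hT.period_dvd_period (pow_dvd_pow π n.le_succ) x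
  rw [Nat.succ_eq_add_one] at hj
  have hk : 0 < period T (π ^ n) x := Nat.pos_of_ne_zero fun h => by simp [hj, h] at hpos
  have hj1 : 1 ≤ j := Nat.pos_of_ne_zero fun h => by simp [hj, h] at hpos
  have hder := (dvd_pow_self π (by omega : n ≠ 0)).trans (hT.dvd_iterDeriv_period hj)
  obtain ⟨b, hb⟩ := dvd_iterate_period T (π ^ n) x
  have key : ∀ i, period T (π ^ (n + 1)) x ∣ period T (π ^ n) x * i ↔
      π ∣ b * (iterDeriv T D (period T (π ^ n) x) x ^ i - 1) := fun i => by
    rw [← hT.dvd_iterate_iff, pow_succ, hT.mul_dvd_iterate_mul_iff (pow_ne_zero _ hπ.ne_zero)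
      (dvd_pow_self π (by omega)) (by rw [← hb]; ring), ← geom_sum_mul, ← mul_assoc]
    exact ⟨fun h => h.mul_right _, fun h => (hπ.dvd_or_dvd h).resolve_right h1⟩
  by_cases hπb : π ∣ b
  · left
    refine Nat.dvd_antisymm ?_ ⟨j, hj⟩
    simpa using (key 1).2 (hπb.mul_right _)
  · right
    have hone : π ∣ iterDeriv T D (period T (π ^ n) x) x ^ j - 1 :=
      (hπ.dvd_or_dvd ((key j).1 hj.dvd)).resolve_left hπb
    have hunit : ¬ π ∣ iterDeriv T D (period T (π ^ n) x) x := fun h => hπ.not_isUnit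
      (isUnit_of_dvd_one (by simpa using dvd_sub (h.trans (dvd_pow_self _ (Nat.one_le_iff_ne_zero.1 hj1))) hone))
    refine ⟨j, hj1, ?_, hj, dvd_sub_trans hder hone⟩
    have := (key (q - 1)).2 ((hq _ hunit).mul_left b)
    rw [hj] at this
    exact Nat.dvd_of_mul_dvd_mul_left hk this

/-- The shape of the cycle lengths: before the multiplier becomes `1` modulo `π` the length is that
at level `1`; then a factor dividing `q - 1` appears, and afterwards only factors `p`. -/
lemma period_eq (hp : π ∣ (p : R)) (hpp : p.Prime)
    (hq : ∀ a : R, ¬ π ∣ a → π ∣ a ^ (q - 1) - 1) (hpos : ∀ n, 0 < period T (π ^ n) x)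
    {n : ℕ} (hn : 1 ≤ n) :
    period T (π ^ n) x = period T (π ^ 1) x ∨
      (π ∣ iterDeriv T D (period T (π ^ n) x) x - 1 ∧
        ∃ l s, 1 ≤ l ∧ l ∣ q - 1 ∧ period T (π ^ n) x = period T (π ^ 1) x * l * p ^ s) := by
  induction n, hn using Nat.le_induction with
  | base => exact Or.inl rfl
  | succ n hn ih =>
    by_cases h1 : π ∣ iterDeriv T D (period T (π ^ n) x) x - 1
    · obtain ⟨l, s, hl1, hl, hs⟩ : ∃ l s, 1 ≤ l ∧ l ∣ q - 1 ∧
          period T (π ^ n) x = period T (π ^ 1) x * l * p ^ s := by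
        rcases ih with ih | ⟨-, ih⟩
        · exact ⟨1, 0, le_rfl, one_dvd _, by simpa using ih⟩
        · exact ih
      have hstep : ∀ j, period T (π ^ (n + 1)) x = period T (π ^ n) x * j →
          π ∣ iterDeriv T D (period T (π ^ (n + 1)) x) x - 1 := fun j hj =>
        dvd_sub_trans ((dvd_pow_self π (by omega : n ≠ 0)).trans (hT.dvd_iterDeriv_period hj))
          (h1.trans (sub_one_dvd_pow_sub_one _ _))
      right
      rcases hT.period_succ_eq hπ hp hpp hn h1 with h | h
      · exact ⟨hstep 1 (by rw [h, mul_one]), l, s, hl1, hl, by rw [h, hs]⟩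
      · exact ⟨hstep p h, l, s + 1, hl1, hl, by rw [h, hs, pow_succ p, mul_assoc _ (p ^ s)]⟩
    · have ih := ih.resolve_right fun h => h1 h.1
      rcases hT.period_succ_of_not_dvd hπ hq hn (hpos _) h1 with h | ⟨j, hj1, hj, h, h'⟩
      · exact Or.inl (h.trans ih)
      · exact Or.inr ⟨h', j, 0, hj1, hj, by rw [h, ih, pow_zero, mul_one]⟩

/-- If the cycle lengths over `x` are unbounded, the multipliers tend to `1`: they persist modulo
`πⁿ` from level `n` on, and every growth replaces the multiplier by its `p`-th power. -/
lemma eventually_dvd_iterDeriv_sub_one (hp : π ∣ (p : R)) (hpp : p.Prime)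
    (hq : ∀ a : R, ¬ π ∣ a → π ∣ a ^ (q - 1) - 1) (hpos : ∀ n, 0 < period T (π ^ n) x)
    (hunb : ∀ N, ∃ n, N < period T (π ^ n) x) (N : ℕ) :
    ∃ n₀, ∀ n ≥ n₀, π ^ N ∣ iterDeriv T D (period T (π ^ n) x) x - 1 := by
  have hmono : Monotone fun n => period T (π ^ n) x := monotone_nat_of_le_succ fun n =>
    Nat.le_of_dvd (hpos _) (hT.period_dvd_period (pow_dvd_pow π n.le_succ) x)
  have hpersist : ∀ {N n : ℕ}, N ≤ n → π ^ N ∣ iterDeriv T D (period T (π ^ n) x) x - 1 →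
      ∀ m ≥ n, π ^ N ∣ iterDeriv T D (period T (π ^ m) x) x - 1 := by
    intro N n hNn h m hm
    induction m, hm using Nat.le_induction with
    | base => exact h
    | succ m hm ih =>
      obtain ⟨j, hj⟩ := hT.period_dvd_period (pow_dvd_pow π m.le_succ) x
      exact dvd_sub_trans ((pow_dvd_pow π (hNn.trans hm)).trans (hT.dvd_iterDeriv_period hj))
        (ih.trans (sub_one_dvd_pow_sub_one _ _))
  induction N with
  | zero => exact ⟨0, fun n _ => by simp⟩
  | succ N ih =>
    rcases Nat.eq_zero_or_pos N with rfl | hN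
    · obtain ⟨n, hn⟩ := hunb (period T (π ^ 1) x)
      refine ⟨n, fun m hm => ?_⟩
      have hm' : period T (π ^ 1) x < period T (π ^ m) x := hn.trans_le (hmono hm)
      have h1m : 1 ≤ m := by
        by_contra hlt
        exact (hmono (by omega : m ≤ 1)).not_gt hm'
      rw [zero_add, pow_one]
      exact ((hT.period_eq hπ hp hpp hq hpos h1m).resolve_left hm'.ne').1
    · obtain ⟨n₀, h₀⟩ := ih
      set n₁ := max n₀ (N + 1) with hn₁
      obtain ⟨n, hn, hgrow⟩ : ∃ n ≥ n₁, period T (π ^ (n + 1)) x ≠ period T (π ^ n) x := by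
        by_contra! hcon
        have hconst : ∀ m ≥ n₁, period T (π ^ m) x = period T (π ^ n₁) x := by
          intro m hm
          induction m, hm using Nat.le_induction with
          | base => rfl
          | succ m hm ih => rw [hcon m hm, ih]
        obtain ⟨m, hm⟩ := hunb (period T (π ^ n₁) x)
        have := hmono (le_max_left m n₁)
        simp only [hconst _ (le_max_right m n₁)] at this
        omega
      have ha := h₀ n (le_trans (le_max_left _ _) hn)
      have ha1 : π ∣ iterDeriv T D (period T (π ^ n) x) x - 1 :=
        (dvd_pow_self π (by omega)).trans ha
      have hn1 : N + 1 ≤ n := le_trans (le_max_right _ _) hn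
      have hgrow := (hT.period_succ_eq hπ hp hpp (by omega) ha1).resolve_left hgrow
      refine ⟨n + 1, hpersist (by omega) ?_⟩
      refine dvd_sub_trans ((pow_dvd_pow π hn1).trans (hT.dvd_iterDeriv_period hgrow)) ?_
      rw [← geom_sum_mul, mul_comm, pow_succ]
      exact mul_dvd_mul ha ((dvd_iff_dvd_of_dvd_sub (dvd_geom_sum_sub ha1 p)).2 hp)

/-- The exact orders of `T^{k p^i}(x) - x`. -/
lemma pow_dvd_iterate_mul_pow_iff {e k n : ℕ} (hℓ : ∀ ℓ : ℕ, ℓ.Prime → (ℓ : R) ∣ π ^ e)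
    (hpe : Associated (p : R) (π ^ e)) (hn : e + 1 ≤ n)
    (h0 : π ^ n ∣ T^[k] x - x) (h0' : ¬ π ^ (n + 1) ∣ T^[k] x - x)
    (h1 : π ^ (e + 1) ∣ iterDeriv T D k x - 1) (i r : ℕ) :
    π ^ r ∣ T^[k * p ^ i] x - x ↔ r ≤ n + e * i := by
  obtain ⟨c, hc⟩ := hT.exists_iterate_mul_sub_eq hℓ ((pow_dvd_pow π hn).trans h0) h1 (p ^ i)
  obtain ⟨b, hb⟩ := h0
  obtain ⟨u, hu⟩ := hpe.symm
  have hw : T^[k * p ^ i] x - x = π ^ (n + e * i) * ((u : R) ^ i * b * (1 + π * c)) := by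
    rw [hc, hb]
    push_cast
    rw [← hu, mul_pow, ← pow_mul, pow_add]
    ring
  have hb' : ¬ π ∣ b := fun h => h0' (by rw [hb, pow_succ]; exact mul_dvd_mul_left _ h)
  have hnd : ¬ π ∣ (u : R) ^ i * b * (1 + π * c) := by
    intro h
    rcases hπ.dvd_or_dvd h with h | h
    · rcases hπ.dvd_or_dvd h with h | h
      · exact hπ.not_isUnit (isUnit_of_dvd_unit h (u.isUnit.pow i))
      · exact hb' h
    · exact hπ.not_isUnit (isUnit_of_dvd_one ((dvd_add_left (dvd_mul_right π c)).1 h))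
  rw [hw]
  refine ⟨fun h => ?_, fun h => (pow_dvd_pow π h).mul_right _⟩
  by_contra! hlt
  have h2 := (pow_dvd_pow π (Nat.succ_le_of_lt hlt)).trans h
  rw [Nat.succ_eq_add_one, pow_succ, mul_dvd_mul_iff_left (pow_ne_zero _ hπ.ne_zero)] at h2
  exact hnd h2

end HasTaylor

/-- The class of `x` modulo `π ^ n` is in a cycle all of whose lifts through `x` grow in the
generations divisible by `e` and split in the others. -/
def HasGrowthPattern (T D : R → R) (π : R) (e n : ℕ) (x : R) : Prop :=
  ∀ m, 0 < period T (π ^ (n + m)) x ∧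
    π ∣ iterDeriv T D (period T (π ^ (n + m)) x) x - 1 ∧
    (π ^ (n + m + 1) ∣ T^[period T (π ^ (n + m)) x] x - x ↔ ¬ e ∣ m)

namespace HasTaylor

variable (hT : HasTaylor T D) (hπ : Prime π)
include hT hπ

/-- Once the multiplier is `1` modulo `π ^ (e + 1)`, a growing cycle at a level above `e` starts the
pattern in which growth occurs exactly in every `e`-th generation. -/
lemma hasGrowthPattern_of_grows {e k n : ℕ} (he : 0 < e) (hpp : p.Prime)
    (hℓ : ∀ ℓ : ℕ, ℓ.Prime → (ℓ : R) ∣ π ^ e)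
    (hpe : Associated (p : R) (π ^ e)) (hn : e + 1 ≤ n)
    (hk : period T (π ^ n) x = k) (hk0 : 0 < k)
    (hgrow : ¬ π ^ (n + 1) ∣ T^[k] x - x)
    (h1 : π ^ (e + 1) ∣ iterDeriv T D k x - 1) :
    HasGrowthPattern T D π e n x := by
  intro m
  have h0 : π ^ n ∣ T^[k] x - x := hk ▸ dvd_iterate_period T (π ^ n) x
  have key := hT.pow_dvd_iterate_mul_pow_iff hπ hℓ hpe hn h0 hgrow h1
  obtain ⟨c, hc⟩ : ∃ c, m ≤ e * c ∧ e * c < m + e := by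
    refine ⟨(m + e - 1) / e, ?_, ?_⟩
    · have := Nat.div_add_mod (m + e - 1) e
      have := Nat.mod_lt (m + e - 1) he
      omega
    · have := Nat.mul_div_le (m + e - 1) e
      omega
  have hdvd : period T (π ^ (n + m)) x ∣ k * p ^ c :=
    hT.dvd_iterate_iff.1 ((key c (n + m)).2 (by omega))
  obtain ⟨j, hj⟩ := hT.period_dvd_period (pow_dvd_pow π (Nat.le_add_right n m)) x
  rw [hk] at hj
  rw [hj] at hdvd ⊢
  obtain ⟨i, hic, rfl⟩ := (Nat.dvd_prime_pow hpp).1 (Nat.dvd_of_mul_dvd_mul_left hk0 hdvd)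
  have hi : n + m ≤ n + e * i := (key i (n + m)).1 (hj ▸ dvd_iterate_period T (π ^ (n + m)) x)
  have hei : e * i ≤ e * c := Nat.mul_le_mul_left e hic
  refine ⟨Nat.mul_pos hk0 (pow_pos hpp.pos _), ?_, ?_⟩
  · exact hT.dvd_iterDeriv_mul_sub_one ((dvd_pow_self π (by omega : n ≠ 0)).trans h0)
      ((dvd_pow_self π (by omega)).trans h1) _
  · rw [key]
    constructor
    · rintro h ⟨d, rfl⟩
      have : i ≤ d := by
        by_contra! hdi
        have h2 := Nat.mul_le_mul_left e (show d + 1 ≤ i from hdi)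
        rw [mul_add_one] at h2
        omega
      have := Nat.mul_le_mul_left e this
      omega
    · intro h
      have : m ≠ e * i := fun h' => h ⟨i, h'⟩
      omega

/-- A point that is periodic at all levels, with unbounded periods, lies in a growing cycle
with the regular pattern of descendants. -/
lemma exists_hasGrowthPattern {e : ℕ} (he : 0 < e) (hpp : p.Prime)
    (hℓ : ∀ ℓ : ℕ, ℓ.Prime → (ℓ : R) ∣ π ^ e) (hpe : Associated (p : R) (π ^ e))
    (hq : ∀ a : R, ¬ π ∣ a → π ∣ a ^ (q - 1) - 1) (hpos : ∀ n, 0 < period T (π ^ n) x)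
    (hunb : ∀ N, ∃ n, N < period T (π ^ n) x) :
    ∃ n, 1 ≤ n ∧ (∃ l s, 1 ≤ l ∧ l ∣ q - 1 ∧ period T (π ^ n) x = period T (π ^ 1) x * l * p ^ s) ∧
      ∀ y ∈ visited T (π ^ n) x, HasGrowthPattern T D π e n y := by
  have hp : π ∣ (p : R) := (dvd_pow_self π he.ne').trans hpe.symm.dvd
  obtain ⟨n₀, h₀⟩ := hT.eventually_dvd_iterDeriv_sub_one hπ hp hpp hq hpos hunb (e + 1)
  obtain ⟨n, hn, hgrow⟩ : ∃ n ≥ max n₀ (e + 1),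
      ¬ π ^ (n + 1) ∣ T^[period T (π ^ n) x] x - x := by
    by_contra! hcon
    set n₁ := max n₀ (e + 1)
    have hconst : ∀ m ≥ n₁, period T (π ^ m) x = period T (π ^ n₁) x := by
      intro m hm
      induction m, hm using Nat.le_induction with
      | base => rfl
      | succ m hm ih =>
        rw [← ih]
        exact Nat.dvd_antisymm (hT.dvd_iterate_iff.1 (hcon m hm))
          (hT.period_dvd_period (pow_dvd_pow π m.le_succ) x)
    obtain ⟨m, hm⟩ := hunb (period T (π ^ n₁) x)
    have := Nat.le_of_dvd (hpos _) (hT.period_dvd_period (pow_dvd_pow π (le_max_left m n₁)) x)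
    rw [hconst _ (le_max_right m n₁)] at this
    omega
  have hne : e + 1 ≤ n := (le_max_right _ _).trans hn
  have h1 := h₀ n ((le_max_left _ _).trans hn)
  refine ⟨n, by omega, ?_, ?_⟩
  · rcases hT.period_eq hπ hp hpp hq hpos (show 1 ≤ n by omega) with h | ⟨-, h⟩
    · exact ⟨1, 0, le_rfl, one_dvd _, by rw [h]; ring⟩
    · exact h
  rintro y ⟨i, hi⟩
  have h0 := dvd_iterate_period T (π ^ n) x
  obtain ⟨t, ht⟩ := hT.exists_iterate_return (hpos n) hi
  have hy0 : π ^ n ∣ T^[period T (π ^ n) x] y - y := by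
    refine hT.dvd_iterate_congr hi ?_
    rw [← Function.iterate_add_apply, add_comm, Function.iterate_add_apply]
    exact hT.dvd_iterate h0 i
  have hcomm : ∀ {d : R} {j : ℕ}, d ∣ T^[j] y - y → d ∣ T^[j] (T^[t] y) - T^[t] y := by
    intro d j hd
    rw [← Function.iterate_add_apply, add_comm, Function.iterate_add_apply]
    exact hT.dvd_iterate hd t
  have hyd : π ^ n ∣ iterDeriv T D (period T (π ^ n) x) y
      - iterDeriv T D (period T (π ^ n) x) x :=
    dvd_sub_trans ((dvd_sub_comm).1 (hT.dvd_iterDeriv_iterate hy0 t))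
      (ht.trans (hT.sub_dvd_iterDeriv _ _ _))
  refine hT.hasGrowthPattern_of_grows hπ he hpp hℓ hpe hne
    (Nat.dvd_antisymm (hT.dvd_iterate_iff.1 hy0) (hT.dvd_iterate_iff.1
      (hT.dvd_iterate_congr ht (hcomm (dvd_iterate_period T (π ^ n) y))))) (hpos n) ?_
    (dvd_sub_trans ((pow_dvd_pow π hne).trans hyd) h1)
  -- Up to `π ^ (n + 1)`, the displacement `T^k - id` is constant on each class of the cycle.
  intro hcon
  refine hgrow ?_
  obtain ⟨r, hr⟩ := hT.taylor_iterate (period T (π ^ n) x) x (T^[t] y - x)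
  rw [add_sub_cancel] at hr
  have h2 := hcomm hcon
  have h3 : π ^ (n + 1) ∣ (T^[t] y - x) * (iterDeriv T D (period T (π ^ n) x) x - 1) := by
    rw [pow_succ]
    exact mul_dvd_mul ht ((dvd_pow_self π (by omega)).trans h1)
  have h4 : π ^ (n + 1) ∣ (T^[t] y - x) ^ 2 * r := by
    rw [sq, mul_assoc, pow_succ]
    exact mul_dvd_mul ht (((dvd_pow_self π (by omega : n ≠ 0)).trans ht).mul_right _)
  have h5 : T^[period T (π ^ n) x] x - x = T^[period T (π ^ n) x] (T^[t] y) - T^[t] y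
      - (T^[t] y - x) * (iterDeriv T D (period T (π ^ n) x) x - 1) - (T^[t] y - x) ^ 2 * r := by
    rw [hr]; ring
  rw [h5]
  exact dvd_sub (dvd_sub h2 h3) h4

end HasTaylor

end Growth

/-! ### Cycles at a level and sets of type `(k, e)` -/

section Cycles

variable {K : Type*} [NormedField K] [IsUltrametricDist K]

lemma mk_eq_mk_iff {d x y : 𝒪[K]} :
    Ideal.Quotient.mk (Ideal.span {d}) x = Ideal.Quotient.mk (Ideal.span {d}) y ↔ d ∣ x - y := by
  rw [Ideal.Quotient.eq, Ideal.mem_span_singleton]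

lemma IsConvergent.hasTaylor [CompleteSpace 𝒪[K]] {φ : 𝒪[K]⟦X⟧} (hφ : IsConvergent φ) :
    HasTaylor (toMap φ) (toMap (PowerSeries.derivative 𝒪[K] φ)) :=
  ⟨hφ.exists_toMap_add, hφ.derivative.sub_dvd⟩

variable {φ : 𝒪[K]⟦X⟧} {π : 𝒪[K]} {n k e p : ℕ} {x y : 𝒪[K]}
  {σ : ZMod k → 𝒪[K] ⧸ Ideal.span {π ^ n}}

lemma grows_iff [IsDomain 𝒪[K]] (hπ : π ≠ 0) : Grows φ π n k σ ↔ ∀ x ∈ cycleSet π n k σ, π ∣ multiplier φ k x - 1 ∧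
    π ^ n ∣ (toMap φ)^[k] x - x ∧ ¬ π ^ (n + 1) ∣ (toMap φ)^[k] x - x := by
  refine forall₂_congr fun x _ => and_congr_right fun _ => ⟨?_, ?_⟩
  · rintro ⟨b, hb, hb'⟩
    rw [hb, pow_succ, mul_dvd_mul_iff_left (pow_ne_zero n hπ)]
    exact ⟨dvd_mul_right _ _, hb'⟩
  · rintro ⟨⟨b, hb⟩, hb'⟩
    rw [hb, pow_succ, mul_dvd_mul_iff_left (pow_ne_zero n hπ)] at hb'
    exact ⟨b, hb, hb'⟩

lemma IsCycle.mk_iterate (hσ : IsCycle φ π n k σ) {i : ZMod k}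
    (hx : Ideal.Quotient.mk (Ideal.span {π ^ n}) x = σ i) (j : ℕ) :
    Ideal.Quotient.mk (Ideal.span {π ^ n}) ((toMap φ)^[j] x) = σ (i + j) := by
  induction j with
  | zero => simpa using hx
  | succ j ih =>
    rw [Function.iterate_succ_apply', hσ.2.2 _ _ ih]
    push_cast
    rw [add_assoc]

lemma IsCycle.period_eq (hT : HasTaylor (toMap φ) (toMap (PowerSeries.derivative 𝒪[K] φ)))
    (hσ : IsCycle φ π n k σ) (hx : x ∈ cycleSet π n k σ) :
    period (toMap φ) (π ^ n) x = k := by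
  obtain ⟨i, hi⟩ := hx
  have h : ∀ j, period (toMap φ) (π ^ n) x ∣ j ↔ k ∣ j := fun j => by
    rw [← hT.dvd_iterate_iff, ← mk_eq_mk_iff, hσ.mk_iterate hi.symm, ← hi, hσ.2.1.eq_iff,
      add_eq_left, ZMod.natCast_eq_zero_iff]
  exact Nat.dvd_antisymm ((h k).2 dvd_rfl) ((h _).1 dvd_rfl)

lemma IsCycle.cycleSet_eq (hσ : IsCycle φ π n k σ) (hx : x ∈ cycleSet π n k σ) :
    cycleSet π n k σ = visited (toMap φ) (π ^ n) x := by
  obtain ⟨i, hi⟩ := hx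
  have : NeZero k := ⟨hσ.1.ne'⟩
  ext y
  constructor
  · rintro ⟨i', hi'⟩
    refine ⟨(i' - i).val, ?_⟩
    rw [← mk_eq_mk_iff, hσ.mk_iterate hi.symm, ← hi', ZMod.natCast_zmod_val, add_sub_cancel]
  · rintro ⟨j, hj⟩
    rw [← mk_eq_mk_iff, hσ.mk_iterate hi.symm] at hj
    exact ⟨_, hj⟩

lemma exists_isCycle (hT : HasTaylor (toMap φ) (toMap (PowerSeries.derivative 𝒪[K] φ)))
    (hk : period (toMap φ) (π ^ n) x = k) (hpos : 0 < k) :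
    ∃ σ : ZMod k → 𝒪[K] ⧸ Ideal.span {π ^ n}, IsCycle φ π n k σ ∧ x ∈ cycleSet π n k σ := by
  have : NeZero k := ⟨hpos.ne'⟩
  have hper : ∀ a b : ℕ, (a : ZMod k) = b → π ^ n ∣ (toMap φ)^[a] x - (toMap φ)^[b] x := by
    intro a b hab
    wlog h : b ≤ a generalizing a b
    · exact (dvd_sub_comm).1 (this b a hab.symm (le_of_not_ge h))
    obtain ⟨c, rfl⟩ := Nat.exists_eq_add_of_le h
    have hc : k ∣ c := by
      rw [Nat.cast_add, add_eq_left] at hab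
      exact (ZMod.natCast_eq_zero_iff _ _).1 hab
    rw [Function.iterate_add_apply]
    exact hT.dvd_iterate (hT.dvd_iterate_iff.2 (hk ▸ hc)) b
  refine ⟨fun i => Ideal.Quotient.mk _ ((toMap φ)^[i.val] x), ⟨hpos, ?_, ?_⟩, 0, by simp⟩
  · intro i j hij
    exact ZMod.val_injective k (hT.eq_of_dvd_iterate_sub (hk ▸ i.val_lt) (hk ▸ j.val_lt)
      (mk_eq_mk_iff.1 hij))
  · intro i y hy
    refine mk_eq_mk_iff.2 (dvd_sub_trans ((mk_eq_mk_iff.1 hy).trans (hT.sub_dvd _ _)) ?_)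
    rw [← Function.iterate_succ_apply' (toMap φ)]
    exact hper _ _ (by simp)

/-- Sets of type `(k, e)` in terms of periods. -/
lemma HasType.exists_level {S : Set 𝒪[K]} [IsDomain 𝒪[K]]
    (hT : HasTaylor (toMap φ) (toMap (PowerSeries.derivative 𝒪[K] φ))) (hπ : Prime π)
    (hp : π ∣ (p : 𝒪[K])) (hp0 : 0 < p) (hS : HasType φ π k e S) :
    ∃ n, 1 ≤ n ∧ S.Nonempty ∧ (∀ x ∈ S, S = visited (toMap φ) (π ^ n) x) ∧
      ∀ x ∈ S, HasGrowthPattern (toMap φ) (toMap (PowerSeries.derivative 𝒪[K] φ)) π e n x := by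
  obtain ⟨n, σ, hn, hσ, rfl, -, hdesc⟩ := hS
  have : NeZero k := ⟨hσ.1.ne'⟩
  have hsub : ∀ x ∈ cycleSet π n k σ, ∀ m, visited (toMap φ) (π ^ (n + m)) x ⊆ cycleSet π n k σ := by
    intro x hx m y ⟨j, hj⟩
    rw [hσ.cycleSet_eq hx]
    exact ⟨j, (pow_dvd_pow π (Nat.le_add_right n m)).trans hj⟩
  refine ⟨n, hn, ?_, fun x hx => hσ.cycleSet_eq hx, ?_⟩
  · obtain ⟨x, hx⟩ := Ideal.Quotient.mk_surjective (σ 0)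
    exact ⟨x, 0, hx.symm⟩
  intro x hx
  have key : ∀ m, 0 < period (toMap φ) (π ^ (n + m)) x →
      π ∣ multiplier φ (period (toMap φ) (π ^ (n + m)) x) x - 1 ∧
      (π ^ (n + m + 1) ∣ (toMap φ)^[period (toMap φ) (π ^ (n + m)) x] x - x ↔ ¬ e ∣ m) := by
    intro m hm
    obtain ⟨τ, hτ, hxτ⟩ := exists_isCycle hT rfl hm
    have h := hdesc m _ τ hτ (by rw [hτ.cycleSet_eq hxτ]; exact hsub x hx m)
    by_cases hem : e ∣ m
    · have := (grows_iff hπ.ne_zero).1 (h.1 hem) x hxτ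
      exact ⟨this.1, by simp [hem, this.2.2]⟩
    · obtain ⟨h1, b, hb, c, rfl⟩ := h.2 hem x hxτ
      exact ⟨h1, by simp only [hem, not_false_eq_true, iff_true]; exact ⟨c, by rw [hb]; ring⟩⟩
  have hpos : ∀ m, 0 < period (toMap φ) (π ^ (n + m)) x := by
    intro m
    induction m with
    | zero => rw [add_zero, hσ.period_eq hT hx]; exact hσ.1
    | succ m ih =>
      exact Nat.pos_of_dvd_of_pos (hT.period_succ_dvd_mul hπ hp (show 1 ≤ n + m by omega) (key m ih).1)
        (Nat.mul_pos ih hp0)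
  exact fun m => ⟨hpos m, key m (hpos m)⟩

lemma hasType_visited (hT : HasTaylor (toMap φ) (toMap (PowerSeries.derivative 𝒪[K] φ)))
    [IsDomain 𝒪[K]] (hπ : Prime π) (hn : 1 ≤ n) (hk : period (toMap φ) (π ^ n) x = k)
    (h : ∀ y ∈ visited (toMap φ) (π ^ n) x,
      HasGrowthPattern (toMap φ) (toMap (PowerSeries.derivative 𝒪[K] φ)) π e n y) :
    HasType φ π k e (visited (toMap φ) (π ^ n) x) := by
  have hpos := (h x (mem_visited_self _ _ _) 0).1
  rw [add_zero, hk] at hpos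
  obtain ⟨σ, hσ, hx⟩ := exists_isCycle hT hk hpos
  have hmain : ∀ (m k' : ℕ) (τ : ZMod k' → 𝒪[K] ⧸ Ideal.span {π ^ (n + m)}),
      IsCycle φ π (n + m) k' τ → cycleSet π (n + m) k' τ ⊆ cycleSet π n k σ →
        (e ∣ m → Grows φ π (n + m) k' τ) ∧ (¬ e ∣ m → Splits φ π (n + m) k' τ) := by
    intro m k' τ hτ hsub
    refine ⟨fun hem => (grows_iff hπ.ne_zero).2 fun y hy => ?_, fun hem y hy => ?_⟩ <;>
    · have hy' := hsub hy
      rw [hσ.cycleSet_eq hx] at hy'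
      have := h y hy' m
      have hd := dvd_iterate_period (toMap φ) (π ^ (n + m)) y
      rw [hτ.period_eq hT hy] at this hd
      simp only [hem, not_true_eq_false, iff_false, not_false_eq_true, iff_true] at this
      first
      | exact ⟨this.2.1, hd, this.2.2⟩
      | obtain ⟨c, hc⟩ := this.2.2
        exact ⟨this.2.1, π * c, by rw [hc]; ring, dvd_mul_right _ _⟩
  exact ⟨n, σ, hn, hσ, (hσ.cycleSet_eq hx).symm, (hmain 0 k σ hσ subset_rfl).1 (dvd_zero e), hmain⟩

end Cycles

/-! ### The uniformizer -/

section Uniformizer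

variable {K : Type*} [NormedField K] [IsUltrametricDist K] {π : 𝒪[K]}

lemma norm_integer_mul (x y : 𝒪[K]) : ‖x * y‖ = ‖x‖ * ‖y‖ := norm_mul (x : K) y

lemma norm_integer_pow (x : 𝒪[K]) (n : ℕ) : ‖x ^ n‖ = ‖x‖ ^ n := norm_pow (x : K) n

lemma integer_dvd_iff {x y : 𝒪[K]} : x ∣ y ↔ ‖y‖ ≤ ‖x‖ := by
  refine ⟨?_, fun h => ?_⟩
  · rintro ⟨c, rfl⟩
    exact norm_integer_mul_le _ _
  · rcases eq_or_ne x 0 with rfl | hx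
    · rw [norm_zero, norm_le_zero_iff] at h
      rw [h]
    · have hx' : (x : K) ≠ 0 := fun h => hx (Subtype.ext h)
      refine ⟨⟨(y : K) / x, mem_integer_iff.2 ?_⟩, Subtype.ext ?_⟩
      · rw [norm_div]
        exact div_le_one_of_le₀ h (norm_nonneg _)
      · exact (mul_div_cancel₀ _ hx').symm

lemma isUnit_integer_iff {x : 𝒪[K]} : IsUnit x ↔ ‖x‖ = 1 := by
  rw [isUnit_iff_dvd_one, integer_dvd_iff]
  have h1 : ‖(1 : 𝒪[K])‖ = 1 := norm_one (α := K)
  rw [h1]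
  exact ⟨fun h => le_antisymm (norm_integer_le_one x) h, fun h => h.ge⟩

lemma pow_dvd_sub_iff {n : ℕ} {x y : 𝒪[K]} : π ^ n ∣ x - y ↔ dist x y ≤ ‖π‖ ^ n := by
  rw [integer_dvd_iff, norm_integer_pow, dist_eq_norm]

lemma setOf_pow_dvd_mem_nhds (hπ0 : π ≠ 0) (n : ℕ) (x : 𝒪[K]) : {y | π ^ n ∣ y - x} ∈ 𝓝 x := by
  simp only [pow_dvd_sub_iff]
  exact Metric.closedBall_mem_nhds x (pow_pos (norm_pos_iff.2 hπ0) n)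

lemma exists_setOf_pow_dvd_subset (hπ1 : ‖π‖ < 1) {x : 𝒪[K]} {U : Set 𝒪[K]} (hU : U ∈ 𝓝 x) :
    ∃ n : ℕ, ∀ y, π ^ n ∣ y - x → y ∈ U := by
  obtain ⟨ε, hε, h⟩ := Metric.mem_nhds_iff.1 hU
  obtain ⟨n, hn⟩ := exists_pow_lt_of_lt_one hε hπ1
  exact ⟨n, fun y hy => h ((pow_dvd_sub_iff.1 hy).trans_lt hn)⟩

lemma eq_of_forall_pow_dvd_sub (hπ1 : ‖π‖ < 1) {x y : 𝒪[K]} (h : ∀ n : ℕ, π ^ n ∣ x - y) :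
    x = y := by
  by_contra hne
  obtain ⟨n, hn⟩ := exists_pow_lt_of_lt_one (dist_pos.2 hne) hπ1
  exact (pow_dvd_sub_iff.1 (h n)).not_gt hn

lemma mem_closure_iff_pow_dvd (hπ0 : π ≠ 0) (hπ1 : ‖π‖ < 1) {x : 𝒪[K]} {S : Set 𝒪[K]} :
    x ∈ closure S ↔ ∀ n : ℕ, ∃ y ∈ S, π ^ n ∣ y - x := by
  rw [mem_closure_iff_nhds]
  constructor
  · intro h n
    obtain ⟨y, hy, hyS⟩ := h _ (setOf_pow_dvd_mem_nhds hπ0 n x)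
    exact ⟨y, hyS, hy⟩
  · intro h U hU
    obtain ⟨n, hn⟩ := exists_setOf_pow_dvd_subset hπ1 hU
    obtain ⟨y, hyS, hy⟩ := h n
    exact ⟨y, hn y hy, hyS⟩

lemma isClopen_of_pow_dvd (hπ0 : π ≠ 0) {n : ℕ} {S : Set 𝒪[K]}
    (h : ∀ x y, π ^ n ∣ x - y → x ∈ S → y ∈ S) : IsClopen S := by
  constructor
  · rw [← isOpen_compl_iff, isOpen_iff_mem_nhds]
    intro x hx
    filter_upwards [setOf_pow_dvd_mem_nhds hπ0 n x] with y hy hyS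
    exact hx (h y x hy hyS)
  · rw [isOpen_iff_mem_nhds]
    intro x hx
    filter_upwards [setOf_pow_dvd_mem_nhds hπ0 n x] with y hy
    exact h x y ((dvd_sub_comm).1 hy) hx

variable {p e f : ℕ}

section

variable [hpp : Fact p.Prime]

lemma IsUniformizer.norm_eq (hπ : IsUniformizer p e π) : ‖π‖ = (p : ℝ) ^ (-(1 / e : ℝ)) := by
  have hp1 : (1 : ℝ) < p := by exact_mod_cast hpp.out.one_lt
  have hpos : 0 < ‖(π : K)‖ := norm_pos_iff.2 fun h => hπ.1 (Subtype.ext h)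
  rw [← hπ.2, neg_neg]
  exact (Real.rpow_logb (by linarith) hp1.ne' hpos).symm

lemma IsUniformizer.norm_lt_one (hπ : IsUniformizer p e π) (he : 0 < e) : ‖π‖ < 1 := by
  have hp1 : (1 : ℝ) < p := by exact_mod_cast hpp.out.one_lt
  rw [hπ.norm_eq]
  exact Real.rpow_lt_one_of_one_lt_of_neg hp1 (by simpa using he)

lemma IsUniformizer.norm_pow_eq (hπ : IsUniformizer p e π) (he : 0 < e) :
    ‖π‖ ^ e = (p : ℝ)⁻¹ := by
  rw [hπ.norm_eq, ← Real.rpow_natCast, ← Real.rpow_mul (Nat.cast_nonneg p), neg_mul,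
    one_div_mul_cancel (by exact_mod_cast he.ne'), Real.rpow_neg_one]

lemma IsUniformizer.dvd_iff (hπ : IsUniformizer p e π) (he : IsRamificationIndex p K e)
    {x : 𝒪[K]} : π ∣ x ↔ ‖x‖ < 1 := by
  rw [integer_dvd_iff]
  refine ⟨fun h => h.trans_lt (hπ.norm_lt_one he.1), fun h => ?_⟩
  rcases eq_or_ne x 0 with rfl | hx
  · simp
  have hx' : (x : K) ≠ 0 := fun h => hx (Subtype.ext h)
  have hp1 : (1 : ℝ) < p := by exact_mod_cast hpp.out.one_lt
  have he' : (0 : ℝ) < e := by exact_mod_cast he.1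
  have hpos : 0 < ‖(x : K)‖ := norm_pos_iff.2 hx'
  have hmem : -Real.logb p ‖(x : K)‖ ∈ {r : ℝ | ∃ x : K, x ≠ 0 ∧ -Real.logb p ‖x‖ = r} :=
    ⟨x, hx', rfl⟩
  rw [he.2] at hmem
  obtain ⟨m, hm⟩ := hmem
  have hlog : Real.logb p ‖(x : K)‖ < 0 := Real.logb_neg hp1 hpos h
  have hm0 : (0 : ℝ) < m := by
    by_contra hcon
    have := div_nonpos_of_nonpos_of_nonneg (not_lt.1 hcon) he'.le
    linarith
  have hm1 : (1 : ℝ) ≤ m := by exact_mod_cast (by exact_mod_cast hm0 : 0 < m)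
  have h1 : 1 / (e : ℝ) ≤ m / e := div_le_div_of_nonneg_right hm1 he'.le
  rw [hπ.norm_eq]
  change ‖(x : K)‖ ≤ _
  rw [← Real.rpow_logb (by linarith : (0 : ℝ) < p) hp1.ne' hpos]
  exact Real.rpow_le_rpow_of_exponent_le hp1.le (by linarith)

lemma IsUniformizer.prime (hπ : IsUniformizer p e π) (he : IsRamificationIndex p K e) :
    Prime π := by
  refine ⟨hπ.1, fun h => ?_, fun a b h => ?_⟩
  · exact (hπ.norm_lt_one he.1).ne (isUnit_integer_iff.1 h)
  · simp only [hπ.dvd_iff he, norm_integer_mul] at h ⊢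
    by_contra! hcon
    exact h.not_ge (one_le_mul_of_one_le_of_one_le hcon.1 hcon.2)

lemma IsUniformizer.residue_eq_zero_iff (hπ : IsUniformizer p e π)
    (he : IsRamificationIndex p K e) {x : 𝒪[K]} : IsLocalRing.residue 𝒪[K] x = 0 ↔ π ∣ x := by
  rw [IsLocalRing.residue_eq_zero_iff, IsLocalRing.mem_maximalIdeal, mem_nonunits_iff,
    isUnit_integer_iff, hπ.dvd_iff he]
  exact ⟨fun h => lt_of_le_of_ne (norm_integer_le_one x) h, fun h => h.ne⟩

lemma finite_residueField (hf : Nat.card 𝓀[K] = p ^ f) : Finite 𝓀[K] :=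
  Nat.finite_of_card_ne_zero (by rw [hf]; exact (pow_pos hpp.out.pos f).ne')

lemma IsUniformizer.dvd_pow_card_sub_one (hπ : IsUniformizer p e π)
    (he : IsRamificationIndex p K e) (hf : Nat.card 𝓀[K] = p ^ f) {a : 𝒪[K]} (ha : ¬ π ∣ a) :
    π ∣ a ^ (p ^ f - 1) - 1 := by
  have := finite_residueField hf
  have := Fintype.ofFinite 𝓀[K]
  rw [← hπ.residue_eq_zero_iff he] at ha ⊢
  rw [map_sub, map_pow, map_one, sub_eq_zero, ← hf, Nat.card_eq_fintype_card]
  exact FiniteField.pow_card_sub_one_eq_one _ ha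

lemma IsUniformizer.period_le (hπ : IsUniformizer p e π) (he : IsRamificationIndex p K e)
    (hf : Nat.card 𝓀[K] = p ^ f) {T D : 𝒪[K] → 𝒪[K]} (hT : HasTaylor T D) (x : 𝒪[K]) :
    period T π x ≤ p ^ f := by
  have := finite_residueField hf
  have hinj : Function.Injective fun i : Fin (period T π x) =>
      IsLocalRing.residue 𝒪[K] (T^[i] x) := by
    intro i j hij
    refine Fin.ext (hT.eq_of_dvd_iterate_sub i.2 j.2 ((hπ.residue_eq_zero_iff he).1 ?_))
    rw [map_sub, sub_eq_zero]
    exact hij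
  have := Nat.card_le_card_of_injective _ hinj
  rwa [hf, Nat.card_fin] at this

lemma one_lt_card (hf : Nat.card 𝓀[K] = p ^ f) : 1 < p ^ f := by
  have := finite_residueField hf
  rw [← hf]
  exact Finite.one_lt_card

end

variable [hpp : Fact p.Prime] [NormedAlgebra ℚ_[p] K]

lemma norm_natCast_eq (n : ℕ) : ‖(n : 𝒪[K])‖ = ‖(n : ℚ_[p])‖ := by
  rw [← norm_algebraMap' K (n : ℚ_[p]), map_natCast]
  rfl

lemma IsUniformizer.associated (hπ : IsUniformizer p e π) (he : 0 < e) :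
    Associated (p : 𝒪[K]) (π ^ e) := by
  have h : ‖(p : 𝒪[K])‖ = ‖π ^ e‖ := by
    rw [norm_natCast_eq (p := p), Padic.norm_p, norm_integer_pow, hπ.norm_pow_eq he]
  exact associated_of_dvd_dvd (integer_dvd_iff.2 h.ge) (integer_dvd_iff.2 h.le)

lemma IsUniformizer.natCast_dvd_pow (hπ : IsUniformizer p e π) (he : 0 < e) {l : ℕ}
    (hl : l.Prime) : (l : 𝒪[K]) ∣ π ^ e := by
  by_cases h : l = p
  · subst h
    exact (hπ.associated he).dvd
  · rw [integer_dvd_iff, norm_natCast_eq (p := p) l,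
      Padic.norm_natCast_eq_one_iff.2 ((Nat.coprime_primes hpp.out hl).2 (Ne.symm h))]
    exact norm_integer_le_one _

/-- If `K` is unramified and every residue class contains a natural number, then `ℕ` is dense in the
ring of integers, so that `K = ℚ_p`. -/
lemma finrank_eq_one_of_dense [FiniteDimensional ℚ_[p] K] (hπ : IsUniformizer p 1 π)
    (h : ∀ x : 𝒪[K], ∃ c : ℕ, π ∣ x - c) : Module.finrank ℚ_[p] K = 1 := by
  have hdvd : ∀ x : 𝒪[K], ∃ c : ℕ, (p : 𝒪[K]) ∣ x - c := fun x => by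
    obtain ⟨c, hc⟩ := h x
    have := (hπ.associated one_pos).dvd
    rw [pow_one] at this
    exact ⟨c, this.trans hc⟩
  have happrox : ∀ (n : ℕ) (x : 𝒪[K]), ∃ c : ℕ, (p : 𝒪[K]) ^ n ∣ x - c := by
    intro n
    induction n with
    | zero => exact fun x => ⟨0, by simp⟩
    | succ n ih =>
      intro x
      obtain ⟨c, y, hy⟩ := ih x
      obtain ⟨d, z, hz⟩ := hdvd y
      refine ⟨c + p ^ n * d, z, ?_⟩
      push_cast
      linear_combination hy + (p : 𝒪[K]) ^ n * hz
  have hclosed : IsClosed ((⊥ : Subalgebra ℚ_[p] K).toSubmodule : Set K) :=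
    Submodule.closed_of_finiteDimensional _
  have hp1 : ‖(p : 𝒪[K])‖ < 1 := by
    rw [norm_natCast_eq (p := p)]
    exact Padic.norm_p_lt_one
  have hint : ∀ x : 𝒪[K], (x : K) ∈ (⊥ : Subalgebra ℚ_[p] K) := fun x => by
    change (x : K) ∈ ((⊥ : Subalgebra ℚ_[p] K).toSubmodule : Set K)
    rw [← hclosed.closure_eq, Metric.mem_closure_iff]
    intro ε hε
    obtain ⟨n, hn⟩ := exists_pow_lt_of_lt_one hε hp1
    obtain ⟨c, hc⟩ := happrox n x
    exact ⟨((c : 𝒪[K]) : K), natCast_mem (⊥ : Subalgebra ℚ_[p] K) c,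
      (pow_dvd_sub_iff.1 hc).trans_lt hn⟩
  rw [← Subalgebra.bot_eq_top_iff_finrank_eq_one, eq_top_iff]
  intro x _
  have hlim := (tendsto_pow_atTop_nhds_zero_of_lt_one (norm_nonneg _) hp1).const_mul ‖x‖
  rw [mul_zero] at hlim
  obtain ⟨n, hn⟩ := (hlim.eventually_lt_const one_pos).exists
  have hmem : x * (p : K) ^ n ∈ 𝒪[K] := by
    rw [mem_integer_iff, norm_mul, norm_pow]
    exact hn.le
  have hp0 : (p : ℚ_[p]) ≠ 0 := by exact_mod_cast hpp.out.ne_zero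
  have hx : x = ((p : ℚ_[p]) ^ n)⁻¹ • (x * (p : K) ^ n) := by
    rw [eq_inv_smul_iff₀ (pow_ne_zero n hp0), Algebra.smul_def, map_pow, map_natCast, mul_comm]
  rw [hx]
  exact (⊥ : Subalgebra ℚ_[p] K).smul_mem (hint ⟨_, hmem⟩) _

end Uniformizer

/-! ### Recurrent points and periodic points -/

section Recurrence

variable {K : Type*} [NormedField K] [IsUltrametricDist K] {π : 𝒪[K]} {T D : 𝒪[K] → 𝒪[K]}

/-- Every orbit accumulates at some point, and visits each of its neighbourhoods infinitely often. -/
lemma exists_frequently_pow_dvd [CompactSpace 𝒪[K]] (hπ0 : π ≠ 0) (x : 𝒪[K]) :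
    ∃ y, ∀ n : ℕ, ∃ᶠ j in atTop, π ^ n ∣ T^[j] x - y := by
  obtain ⟨y, hy⟩ := exists_clusterPt_of_compactSpace (map (fun j => T^[j] x) atTop)
  exact ⟨y, fun n => (mapClusterPt_iff_frequently.1 hy) _ (setOf_pow_dvd_mem_nhds hπ0 n y)⟩

namespace HasTaylor

variable (hT : HasTaylor T D)
include hT

lemma period_pos_of_frequently {d x y : 𝒪[K]} (h : ∃ᶠ j in atTop, d ∣ T^[j] x - y) :
    0 < period T d y := by
  obtain ⟨i, hi⟩ := h.exists
  obtain ⟨j, hij, hj⟩ := (frequently_atTop'.1 h) i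
  refine period_pos (Nat.sub_pos_of_lt hij) ?_
  have h1 := hT.dvd_iterate ((dvd_sub_comm).1 hi) (j - i)
  rw [← Function.iterate_add_apply, Nat.sub_add_cancel hij.le] at h1
  exact dvd_sub_trans h1 hj

lemma period_pos_of_periodic {d x y : 𝒪[K]} (h : d ∣ x - y) {N : ℕ} (hN : 0 < N)
    (hy : T^[N] y = y) : 0 < period T d x :=
  period_pos hN (hT.dvd_iterate_congr ((dvd_sub_comm).1 h) (by simp [hy]))

lemma isPeriodic_of_bounded (hπ1 : ‖π‖ < 1) {y : 𝒪[K]} (hpos : ∀ n, 0 < period T (π ^ n) y) {N : ℕ}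
    (hN : ∀ n, period T (π ^ n) y ≤ N) : ∃ k, 0 < k ∧ T^[k] y = y := by
  refine ⟨N.factorial, N.factorial_pos, eq_of_forall_pow_dvd_sub hπ1 fun n => ?_⟩
  exact hT.dvd_iterate_iff.2 (Nat.dvd_factorial (hpos n) (hN n))

lemma mem_basin_orbit (hπ1 : ‖π‖ < 1) {x y : 𝒪[K]}
    (h : ∀ n : ℕ, ∃ j, π ^ n ∣ T^[j] x - y) : x ∈ basin T (orbit T y) := by
  rw [basin, Set.mem_ofPred_eq, Metric.tendsto_atTop]
  intro ε hε
  obtain ⟨n, hn⟩ := exists_pow_lt_of_lt_one hε hπ1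
  obtain ⟨j, hj⟩ := h n
  refine ⟨j, fun m hm => ?_⟩
  rw [Real.dist_0_eq_abs, abs_of_nonneg Metric.infDist_nonneg]
  have h1 := hT.dvd_iterate hj (m - j)
  rw [← Function.iterate_add_apply, Nat.sub_add_cancel hm] at h1
  exact (Metric.infDist_le_dist_of_mem (show T^[m - j] y ∈ orbit T y from ⟨m - j, rfl⟩)).trans_lt ((pow_dvd_sub_iff.1 h1).trans_lt hn)

/-- Each growth multiplies the period, so no periodic point meets infinitely many of them. -/
lemma not_periodic_of_hasGrowthPattern {e n N : ℕ} {x : 𝒪[K]} (he : 0 < e)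
    (h : HasGrowthPattern T D π e n x) (hN : 0 < N) : T^[N] x ≠ x := by
  intro hx
  have hlt : ∀ j, j + 1 ≤ period T (π ^ (n + e * j)) x := by
    intro j
    induction j with
    | zero => exact (h (e * 0)).1
    | succ j ih =>
      have h1 : period T (π ^ (n + e * j)) x ≠ period T (π ^ (n + e * (j + 1))) x := by
        intro heq
        refine (h (e * j)).2.2.not_left.2 (dvd_mul_right e j) ?_
        rw [heq]
        refine (pow_dvd_pow π ?_).trans (dvd_iterate_period T (π ^ (n + e * (j + 1))) x)
        rw [mul_add_one]
        omega
      have h2 := Nat.le_of_dvd (h _).1 (hT.period_dvd_period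
        (pow_dvd_pow π (show n + e * j ≤ n + e * (j + 1) by rw [mul_add_one]; omega)) x)
      omega
  have h1 : period T (π ^ (n + e * N)) x ∣ N := hT.dvd_iterate_iff.1 (by simp [hx])
  have := Nat.le_of_dvd hN h1
  have := hlt N
  omega

/-- Near a periodic point whose multiplier is divisible by `π`, there are no others. -/
lemma eq_of_periodic_of_dvd (hπ : Prime π) {k N : ℕ} {x y : 𝒪[K]} (hx : T^[k] x = x)
    (ha : π ∣ iterDeriv T D k x) (hxy : π ∣ y - x) (hN : 0 < N) (hy : T^[N] y = y) : y = x := by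
  have h : ∀ j, π * (y - x) ∣ T^[k * (j + 1)] y - x := by
    have hstep : ∀ z, π ∣ z - x → π * (z - x) ∣ T^[k] z - x := by
      rintro z hz
      obtain ⟨r, hr⟩ := hT.taylor_iterate k x (z - x)
      rw [add_sub_cancel, hx] at hr
      have h1 : T^[k] z - x = (iterDeriv T D k x + (z - x) * r) * (z - x) := by rw [hr]; ring
      rw [h1]
      exact mul_dvd_mul_right (dvd_add ha (hz.mul_right r)) _
    intro j
    induction j with
    | zero => simpa using hstep y hxy
    | succ j ih =>
      rw [mul_add_one k (j + 1), add_comm, Function.iterate_add_apply]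
      have h1 := hstep _ ((dvd_mul_right _ _).trans ih)
      exact ih.trans ((dvd_mul_left _ _).trans h1)
  have h1 := h (N - 1)
  rw [Nat.sub_add_cancel hN, mul_comm k, Function.iterate_mul,
    (show Function.IsFixedPt T^[N] y from hy).iterate k] at h1
  by_contra hne
  obtain ⟨c, hc⟩ := h1
  have h2 : (y - x) * 1 = (y - x) * (π * c) := by linear_combination hc
  exact hπ.not_isUnit (IsUnit.of_mul_eq_one c (mul_left_cancel₀ (sub_ne_zero.2 hne) h2).symm)

/-- Near a periodic point with unit multiplier all periodic points are fixed by one iterate. -/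
lemma exists_iterate_eq_of_periodic [CharZero 𝒪[K]] (hπ : Prime π) {e p q k : ℕ}
    (he : 0 < e) (hp0 : 0 < p) (hq1 : 1 < q)
    (hℓ : ∀ ℓ : ℕ, ℓ.Prime → (ℓ : 𝒪[K]) ∣ π ^ e) (hpe : Associated (p : 𝒪[K]) (π ^ e))
    (hq : ∀ a : 𝒪[K], ¬ π ∣ a → π ∣ a ^ (q - 1) - 1) {x : 𝒪[K]} (hk : 0 < k) (hx : T^[k] x = x)
    (ha : ¬ π ∣ iterDeriv T D k x) :
    ∃ m, 0 < m ∧ ∀ y, π ^ (e + 1) ∣ y - x → ∀ N, 0 < N → T^[N] y = y → T^[m] y = y := by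
  have hp : π ∣ (p : 𝒪[K]) := (dvd_pow_self π he.ne').trans hpe.symm.dvd
  obtain ⟨M, hM, hMa⟩ := exists_pow_dvd_pow_sub_one (by omega) hp hp0 (hq _ ha) e
  refine ⟨k * M, Nat.mul_pos hk hM, fun y hy N hN hyN => ?_⟩
  have hxM : T^[k * M] x - x = 0 := by
    rw [Function.iterate_mul, sub_eq_zero]
    exact (show Function.IsFixedPt T^[k] x from hx).iterate M
  have h0 : π ^ (e + 1) ∣ T^[k * M] y - y :=
    hT.dvd_iterate_congr ((dvd_sub_comm).1 hy) (by simp [hxM])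
  have h1 : π ^ (e + 1) ∣ iterDeriv T D (k * M) y - 1 := by
    refine dvd_sub_trans (hy.trans (hT.sub_dvd_iterDeriv _ _ _)) (dvd_sub_trans ?_ hMa)
    exact hT.dvd_iterDeriv_mul (by simp [hx]) M
  obtain ⟨c, hc⟩ := hT.exists_iterate_mul_sub_eq hℓ h0 h1 N
  rw [mul_comm (k * M) N, Function.iterate_mul,
    (show Function.IsFixedPt T^[N] y from hyN).iterate, sub_self] at hc
  rcases mul_eq_zero.1 hc.symm with h | h
  · rcases mul_eq_zero.1 h with h | h
    · exact absurd (Nat.cast_eq_zero.1 h) hN.ne'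
    · exact sub_eq_zero.1 h
  · exact absurd (IsUnit.of_mul_eq_one (-c) (by linear_combination -h)) hπ.not_isUnit

end HasTaylor

end Recurrence

/-! ### Components -/

section Components

variable {K : Type*} [NormedField K] [IsUltrametricDist K] {π : 𝒪[K]} {T D : 𝒪[K] → 𝒪[K]}

lemma mem_visited_of_dvd {d x y z : 𝒪[K]} (h : d ∣ y - z) (hy : y ∈ visited T d x) :
    z ∈ visited T d x := by
  obtain ⟨j, hj⟩ := hy
  exact ⟨j, dvd_sub_trans hj h⟩

lemma HasTaylor.mapsTo_visited (hT : HasTaylor T D) (d x : 𝒪[K]) :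
    Set.MapsTo T (visited T d x) (visited T d x) := by
  rintro y ⟨j, hj⟩
  refine ⟨j + 1, ?_⟩
  rw [Function.iterate_succ_apply']
  exact hj.trans (hT.sub_dvd _ _)

lemma HasTaylor.isFiniteUnionOfBalls_visited (hT : HasTaylor T D) (hπ0 : π ≠ 0) {n : ℕ} {x : 𝒪[K]}
    (hpos : 0 < period T (π ^ n) x) : IsFiniteUnionOfBalls (visited T (π ^ n) x) := by
  refine ⟨(fun j => (T^[j] x, ‖π‖ ^ n)) '' (Finset.range (period T (π ^ n) x) : Set ℕ),
    (Finset.finite_toSet _).image _, ?_, ?_⟩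
  · rintro _ ⟨j, -, rfl⟩
    exact pow_pos (norm_pos_iff.2 hπ0) n
  · ext y
    simp only [Set.mem_iUnion, Set.mem_image, exists_prop, Metric.mem_closedBall]
    constructor
    · rintro ⟨j, hj⟩
      refine ⟨_, ⟨j % period T (π ^ n) x, by simpa using Nat.mod_lt _ hpos, rfl⟩, ?_⟩
      rw [dist_comm, ← pow_dvd_sub_iff]
      refine dvd_sub_trans ((dvd_sub_comm).1 ?_) hj
      have h := hT.dvd_iterate (hT.dvd_iterate_mul (dvd_iterate_period T (π ^ n) x)
        (j / period T (π ^ n) x)) (j % period T (π ^ n) x)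
      rwa [← Function.iterate_add_apply, Nat.mod_add_div] at h
    · rintro ⟨_, ⟨j, -, rfl⟩, h⟩
      rw [dist_comm] at h
      exact ⟨j, pow_dvd_sub_iff.2 h⟩

lemma HasTaylor.isMinimalSubsystem_closure_orbit (hT : HasTaylor T D) (hπ0 : π ≠ 0) (hπ1 : ‖π‖ < 1)
    {x : 𝒪[K]} (hpos : ∀ n, 0 < period T (π ^ n) x) :
    IsMinimalSubsystem T (closure (orbit T x)) := by
  have hmem : ∀ {z y : 𝒪[K]}, z ∈ closure (orbit T y) ↔ ∀ n : ℕ, ∃ j, π ^ n ∣ T^[j] y - z := by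
    intro z y
    rw [mem_closure_iff_pow_dvd hπ0 hπ1]
    simp [orbit]
  refine ⟨⟨x, subset_closure ⟨0, rfl⟩⟩, isClosed_closure, fun y hy => ?_, fun y hy z hz => ?_⟩
  · rw [hmem] at hy ⊢
    exact fun n => hT.mapsTo_visited _ _ (hy n)
  · rw [hmem] at hy hz ⊢
    intro n
    obtain ⟨i, hi⟩ := hy n
    obtain ⟨j, hj⟩ := hz n
    obtain ⟨t, ht⟩ := hT.exists_iterate_return (hpos n) hi
    refine ⟨j + t, ?_⟩
    rw [Function.iterate_add_apply]
    exact dvd_sub_trans (hT.dvd_iterate ht j) hj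

lemma HasTaylor.period_pos_of_hasGrowthPattern (hT : HasTaylor T D) {e n : ℕ} {x : 𝒪[K]}
    (h : HasGrowthPattern T D π e n x) (N : ℕ) : 0 < period T (π ^ N) x :=
  Nat.pos_of_dvd_of_pos (hT.period_dvd_period (pow_dvd_pow π (Nat.le_add_left N n)) x) (h N).1

variable {p e f : ℕ} [hpp : Fact p.Prime] [NormedAlgebra ℚ_[p] K] [FiniteDimensional ℚ_[p] K]

/-- If some minimal subsystem in a component is open near one of its points `z`, then `z` can be
moved to every nearby point modulo any power of `π`. This contradicts a split, and if there are no
splits then it makes the residue field generated by `1`. -/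
lemma HasTaylor.finrank_eq_one_of_transitive (hT : HasTaylor T D)
    (he : IsRamificationIndex p K e) (hπ : IsUniformizer p e π) {n N : ℕ} {z : 𝒪[K]} (hn : 1 ≤ n)
    (hz : HasGrowthPattern T D π e n z)
    (h : ∀ y, π ^ N ∣ y - z → ∀ r : ℕ, ∃ i, π ^ r ∣ T^[i] z - y) :
    Module.finrank ℚ_[p] K = 1 := by
  have hprime := hπ.prime he
  have hmain : ∀ m, N ≤ m → ∃ b, T^[period T (π ^ (n + m)) z] z - z = π ^ (n + m) * b ∧
      ∀ t, ∃ j : ℕ, π ∣ b * j - t := by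
    intro m hm
    obtain ⟨b, hb⟩ := dvd_iterate_period T (π ^ (n + m)) z
    refine ⟨b, hb, fun t => ?_⟩
    obtain ⟨i, hi⟩ := h (z + π ^ (n + m) * t) (by
      rw [add_sub_cancel_left]
      exact (pow_dvd_pow π (by omega)).mul_right _) (n + m + 1)
    have hi' : π ^ (n + m) ∣ T^[i] z - z := by
      refine dvd_sub_trans ((pow_dvd_pow π (Nat.le_succ _)).trans hi) ?_
      rw [add_sub_cancel_left]
      exact dvd_mul_right _ _
    obtain ⟨j, rfl⟩ := hT.dvd_iterate_iff.1 hi'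
    obtain ⟨c, hc, hcb⟩ := hT.exists_iterate_mul_eq (dvd_pow_self π (by omega : n + m ≠ 0))
      (show T^[period T (π ^ (n + m)) z] z = z + π ^ (n + m) * b by rw [← hb]; ring) j
    rw [hc, add_sub_add_left_eq_sub, ← mul_sub, pow_succ,
      mul_dvd_mul_iff_left (pow_ne_zero _ hprime.ne_zero)] at hi
    refine ⟨j, dvd_sub_trans ?_ hi⟩
    rw [dvd_sub_comm]
    refine dvd_sub_trans hcb ?_
    rw [← mul_sub]
    exact (dvd_geom_sum_sub (hz m).2.1 j).mul_left b
  rcases eq_or_ne e 1 with rfl | he1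
  · obtain ⟨b, -, hb⟩ := hmain N le_rfl
    have hp : π ∣ (p : 𝒪[K]) := by simpa using (hπ.associated one_pos).symm.dvd
    refine finrank_eq_one_of_dense hπ fun t => ?_
    obtain ⟨i, hi⟩ := hb 1
    obtain ⟨j, hj⟩ := hb t
    -- `b` is the inverse of the integer `i`, hence itself an integer modulo `π`.
    have hcop : Nat.Coprime i p := by
      rw [Nat.coprime_comm, hpp.out.coprime_iff_not_dvd]
      rintro hpi
      have h1 : π ∣ (i : 𝒪[K]) := hp.trans (Nat.cast_dvd_cast hpi)
      exact hprime.not_isUnit (isUnit_of_dvd_one (by simpa using dvd_sub (h1.mul_left b) hi))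
    obtain ⟨s, hs⟩ := Nat.exists_mul_mod_eq_one_of_coprime hcop hpp.out.one_lt
    have hs' : (i : 𝒪[K]) * s = p * (i * s / p : ℕ) + 1 := by
      have := Nat.div_add_mod (i * s) p
      rw [hs.2] at this
      rw [← Nat.cast_mul, ← Nat.cast_mul, ← Nat.cast_add_one, this]
    obtain ⟨u, hu⟩ := hi
    obtain ⟨v, hv⟩ := hj
    obtain ⟨w, hw⟩ := hp
    refine ⟨s * j, u * s * j - v - b * j * w * (i * s / p : ℕ), ?_⟩
    push_cast
    rw [hw] at hs'
    linear_combination s * j * hu - hv - b * j * hs'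
  · obtain ⟨m, hm, hem⟩ : ∃ m, N ≤ m ∧ ¬ e ∣ m := by
      refine ⟨e * N + 1, ?_, fun hdvd => he1 ?_⟩
      · have := Nat.le_mul_of_pos_left N he.1
        omega
      · exact Nat.dvd_one.1 ((Nat.dvd_add_right (dvd_mul_right e N)).1 hdvd)
    obtain ⟨b, hb, hbt⟩ := hmain m hm
    have h1 := (hz m).2.2.2 hem
    rw [hb, pow_succ, mul_dvd_mul_iff_left (pow_ne_zero _ hprime.ne_zero)] at h1
    obtain ⟨j, hj⟩ := hbt 1
    exact absurd (isUnit_of_dvd_one (by simpa using dvd_sub (h1.mul_right (j : 𝒪[K])) hj))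
      hprime.not_isUnit

/-- Over `K ≠ ℚ_p` a component is partitioned into minimal subsystems with empty interior, so by
Baire's theorem there are uncountably many of them. -/
lemma HasTaylor.not_countable_minimal [CompactSpace 𝒪[K]] (hT : HasTaylor T D)
    (he : IsRamificationIndex p K e) (hπ : IsUniformizer p e π)
    (hK : Module.finrank ℚ_[p] K ≠ 1) {S : Set 𝒪[K]} {n : ℕ} (hn : 1 ≤ n) (hne : S.Nonempty)
    (hS : ∀ x ∈ S, S = visited T (π ^ n) x) (hpat : ∀ x ∈ S, HasGrowthPattern T D π e n x) :
    ¬ {M : Set 𝒪[K] | M ⊆ S ∧ IsMinimalSubsystem T M}.Countable := by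
  intro hcount
  have hπ1 := hπ.norm_lt_one he.1
  have hclopen : IsClopen S := by
    refine isClopen_of_pow_dvd hπ.1 (n := n) fun x y hxy hx => ?_
    rw [hS x hx]
    exact mem_visited_of_dvd hxy (mem_visited_self _ _ _)
  have hcover : ⋃₀ insert Sᶜ {M : Set 𝒪[K] | M ⊆ S ∧ IsMinimalSubsystem T M} = Set.univ := by
    rw [Set.eq_univ_iff_forall]
    intro x
    by_cases hx : x ∈ S
    · refine ⟨closure (orbit T x), Set.mem_insert_of_mem _ ⟨?_, ?_⟩, subset_closure ⟨0, rfl⟩⟩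
      · refine closure_minimal ?_ hclopen.1
        rintro _ ⟨j, rfl⟩
        rw [hS x hx]
        exact ⟨j, by simp⟩
      · exact hT.isMinimalSubsystem_closure_orbit hπ.1 hπ1
          (hT.period_pos_of_hasGrowthPattern (hpat x hx))
    · exact ⟨Sᶜ, Set.mem_insert _ _, hx⟩
  have hdense := dense_sUnion_interior_of_closed (by
    rintro M (rfl | hM)
    · exact hclopen.compl.1
    · exact hM.2.2.1) (hcount.insert Sᶜ) hcover
  obtain ⟨z, hzS, hz⟩ := hdense.inter_open_nonempty S hclopen.2 hne
  simp only [Set.mem_iUnion] at hz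
  obtain ⟨M, hM, hzM⟩ := hz
  rcases hM with rfl | hM
  · exact interior_subset hzM hzS
  obtain ⟨N, hN⟩ := exists_setOf_pow_dvd_subset hπ1 (mem_interior_iff_mem_nhds.1 hzM)
  refine hK (hT.finrank_eq_one_of_transitive he hπ hn (hpat z hzS) (N := N) fun y hy r => ?_)
  have := (mem_closure_iff_pow_dvd hπ.1 hπ1).1 (hM.2.2.2.2 z (interior_subset hzM) (hN y hy)) r
  simpa [orbit] using this

end Components

/-! ### The decomposition -/

section Decomposition

variable {p : ℕ} [hpp : Fact p.Prime] {K : Type*} [NormedField K] [NormedAlgebra ℚ_[p] K]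
  [IsUltrametricDist K] {e f : ℕ} {π : 𝒪[K]} {φ : 𝒪[K]⟦X⟧}

/-- A point that is periodic at all levels is periodic or lies in a component, according to whether
its periods are bounded. -/
lemma IsConvergent.periodic_or_mem_component [CompleteSpace 𝒪[K]] (hφ : IsConvergent φ)
    (he : IsRamificationIndex p K e) (hf : Nat.card 𝓀[K] = p ^ f) (hπ : IsUniformizer p e π)
    {x : 𝒪[K]} (hpos : ∀ n, 0 < period (toMap φ) (π ^ n) x) :
    (∃ k, 0 < k ∧ (toMap φ)^[k] x = x) ∨ ∃ S, x ∈ S ∧ IsComponent p e f φ π S := by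
  have hT := hφ.hasTaylor
  have hprime := hπ.prime he
  by_cases hb : ∃ N, ∀ n, period (toMap φ) (π ^ n) x ≤ N
  · obtain ⟨N, hN⟩ := hb
    exact Or.inl (hT.isPeriodic_of_bounded (hπ.norm_lt_one he.1) hpos hN)
  · push Not at hb
    obtain ⟨n, hn, ⟨l, s, hl1, hl, hper⟩, hpat⟩ := hT.exists_hasGrowthPattern hprime he.1 hpp.out
      (fun l hl => hπ.natCast_dvd_pow he.1 hl) (hπ.associated he.1)
      (fun a ha => hπ.dvd_pow_card_sub_one he hf ha) hpos hb
    have hle := hπ.period_le he hf hT x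
    rw [← pow_one π] at hle
    exact Or.inr ⟨visited (toMap φ) (π ^ n) x, mem_visited_self _ _ _,
      isClopen_of_pow_dvd hπ.1 fun y z hyz hy => mem_visited_of_dvd hyz hy,
      hT.mapsTo_visited _ _, hT.isFiniteUnionOfBalls_visited hπ.1 (hpos n),
      _, l, s, hpos 1, hle, hl1, hl, hasType_visited hT hprime hn hper hpat⟩

lemma IsComponent.exists_level [CompleteSpace 𝒪[K]] (hφ : IsConvergent φ)
    (he : IsRamificationIndex p K e) (hπ : IsUniformizer p e π) {S : Set 𝒪[K]}
    (hS : IsComponent p e f φ π S) :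
    ∃ n, 1 ≤ n ∧ S.Nonempty ∧ (∀ x ∈ S, S = visited (toMap φ) (π ^ n) x) ∧
      ∀ x ∈ S, HasGrowthPattern (toMap φ) (toMap (PowerSeries.derivative 𝒪[K] φ)) π e n x := by
  obtain ⟨-, -, -, k, l, n, -, -, -, -, h⟩ := hS
  exact h.exists_level hφ.hasTaylor (hπ.prime he)
    ((dvd_pow_self π he.1.ne').trans (hπ.associated he.1).symm.dvd) hpp.out.pos

lemma IsComponent.not_periodic [CompleteSpace 𝒪[K]] (hφ : IsConvergent φ)
    (he : IsRamificationIndex p K e) (hπ : IsUniformizer p e π) {S : Set 𝒪[K]}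
    (hS : IsComponent p e f φ π S) {x : 𝒪[K]} (hx : x ∈ S) {N : ℕ} (hN : 0 < N) :
    (toMap φ)^[N] x ≠ x := by
  obtain ⟨n, -, -, -, h⟩ := hS.exists_level hφ he hπ
  exact hφ.hasTaylor.not_periodic_of_hasGrowthPattern he.1 (h x hx) hN

/-- Components that meet are nested, and their levels are at least `1`, so each is contained in a
maximal one. -/
lemma IsComponent.exists_maximal [CompleteSpace 𝒪[K]] (hφ : IsConvergent φ)
    (he : IsRamificationIndex p K e) (hπ : IsUniformizer p e π) {S : Set 𝒪[K]}
    (hS : IsComponent p e f φ π S) {x : 𝒪[K]} (hx : x ∈ S) :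
    ∃ S', IsComponent p e f φ π S' ∧ ∀ S'', IsComponent p e f φ π S'' → x ∈ S'' → S'' ⊆ S' := by
  classical
  have hex : ∃ n S', IsComponent p e f φ π S' ∧ S' = visited (toMap φ) (π ^ n) x := by
    obtain ⟨n, -, -, h, -⟩ := hS.exists_level hφ he hπ
    exact ⟨n, S, hS, h x hx⟩
  obtain ⟨S', hS', hS'x⟩ := Nat.find_spec hex
  refine ⟨S', hS', fun S'' hS'' hx'' => ?_⟩
  obtain ⟨n, -, -, h, -⟩ := hS''.exists_level hφ he hπ
  have hle : Nat.find hex ≤ n := Nat.find_min' hex ⟨S'', hS'', h x hx''⟩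
  rw [hS'x, h x hx'']
  rintro y ⟨j, hj⟩
  exact ⟨j, (pow_dvd_pow π hle).trans hj⟩

/-- The periodic points are finite in number. At an accumulation point of them the periods are
bounded, since components contain no periodic points; hence it is periodic itself, and infinitely
many periodic points near it are fixed by one iterate, against the identity principle. -/
lemma IsConvergent.finite_periodicPts [CompactSpace 𝒪[K]] (hφ : IsConvergent φ)
    (he : IsRamificationIndex p K e) (hf : Nat.card 𝓀[K] = p ^ f) (hπ : IsUniformizer p e π)
    (hiter : ∀ n : ℕ, 1 ≤ n → (toMap φ)^[n] ≠ id) : (Function.periodicPts (toMap φ)).Finite := by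
  have hT := hφ.hasTaylor
  have hprime := hπ.prime he
  have hchar : CharZero 𝒪[K] := by
    have : CharZero K := charZero_of_injective_algebraMap (algebraMap ℚ_[p] K).injective
    exact ⟨fun a b h => Nat.cast_injective (R := K) (congrArg ((↑) : 𝒪[K] → K) h)⟩
  by_contra hinf
  obtain ⟨x, hx⟩ := Set.Infinite.exists_accPt_principal hinf
  rw [accPt_iff_frequently_nhdsNE] at hx
  have hnear : ∀ n, ∀ᶠ y in 𝓝[≠] x, π ^ n ∣ y - x := fun n =>
    mem_nhdsWithin_of_mem_nhds (setOf_pow_dvd_mem_nhds hπ.1 n x)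
  have hpos : ∀ n, 0 < period (toMap φ) (π ^ n) x := fun n => by
    obtain ⟨y, ⟨N, hN, hy⟩, hyx⟩ := (hx.and_eventually (hnear n)).exists
    exact hT.period_pos_of_periodic ((dvd_sub_comm).1 hyx) hN hy
  rcases hφ.periodic_or_mem_component he hf hπ hpos with ⟨k, hk, hkx⟩ | ⟨S, hxS, hS⟩
  · by_cases ha : π ∣ iterDeriv (toMap φ) (toMap (PowerSeries.derivative 𝒪[K] φ)) k x
    · obtain ⟨y, ⟨⟨N, hN, hy⟩, hyx⟩, hne⟩ :=
        ((hx.and_eventually (hnear 1)).and_eventually self_mem_nhdsWithin).exists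
      exact hne (hT.eq_of_periodic_of_dvd hprime hkx ha (by simpa using hyx) hN hy)
    · obtain ⟨m, hm, h⟩ := hT.exists_iterate_eq_of_periodic hprime he.1 hpp.out.pos
        (one_lt_card hf) (fun l hl => hπ.natCast_dvd_pow he.1 hl) (hπ.associated he.1)
        (fun a ha => hπ.dvd_pow_card_sub_one he hf ha) hk hkx ha
      obtain ⟨y, ⟨⟨N, hN, hy⟩, hyx⟩, hne⟩ := ((hx.and_eventually (hnear (e + 1))).and_eventually
        (hφ.eventually_iterate_ne (hiter m hm) x)).exists
      exact hne (h y hyx N hN hy)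
  · obtain ⟨y, ⟨N, hN, hy⟩, hyS⟩ := (hx.and_eventually
      (mem_nhdsWithin_of_mem_nhds (hS.1.2.mem_nhds hxS))).exists
    exact hS.not_periodic hφ he hπ hyS hN hy

/-- Every orbit is attracted by its accumulation points, which are periodic at all levels. -/
lemma IsConvergent.mem_basin [CompactSpace 𝒪[K]] (hφ : IsConvergent φ)
    (he : IsRamificationIndex p K e) (hf : Nat.card 𝓀[K] = p ^ f) (hπ : IsUniformizer p e π)
    (x : 𝒪[K]) :
    (∃ a ∈ Function.periodicPts (toMap φ), x ∈ basin (toMap φ) (orbit (toMap φ) a)) ∨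
      ∃ S, IsComponent p e f φ π S ∧ ∃ j, (toMap φ)^[j] x ∈ S := by
  have hT := hφ.hasTaylor
  obtain ⟨y, hy⟩ := exists_frequently_pow_dvd (T := toMap φ) hπ.1 x
  rcases hφ.periodic_or_mem_component he hf hπ
    (fun n => hT.period_pos_of_frequently (hy n)) with ⟨k, hk, hky⟩ | ⟨S, hyS, hS⟩
  · exact Or.inl ⟨y, ⟨k, hk, hky⟩,
      hT.mem_basin_orbit (hπ.norm_lt_one he.1) fun n => (hy n).exists⟩
  · obtain ⟨n, hn⟩ := exists_setOf_pow_dvd_subset (hπ.norm_lt_one he.1) (hS.1.2.mem_nhds hyS)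
    obtain ⟨j, hj⟩ := (hy n).exists
    exact Or.inr ⟨S, hS, j, hn _ hj⟩

lemma orbit_finite {X : Type*} {T : X → X} [PseudoMetricSpace X] {a : X}
    (ha : a ∈ Function.periodicPts T) : (orbit T a).Finite := by
  obtain ⟨N, hN, h⟩ := ha
  refine ((Finset.range N).finite_toSet.image fun j => T^[j] a).subset ?_
  rintro _ ⟨j, rfl⟩
  exact ⟨j % N, by simpa using Nat.mod_lt j hN, h.iterate_mod_apply j⟩

lemma mem_basin_of_iterate_mem {X : Type*} [PseudoMetricSpace X] {T : X → X} {S : Set X}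
    (hS : Set.MapsTo T S S) {x : X} {j : ℕ} (h : T^[j] x ∈ S) : x ∈ basin T S := by
  refine tendsto_const_nhds.congr' ?_
  filter_upwards [eventually_ge_atTop j] with m hm
  refine (Metric.infDist_zero_of_mem ?_).symm
  rw [← Nat.sub_add_cancel hm, Function.iterate_add_apply]
  exact hS.iterate _ h

/-- A minimal subsystem attracted by a periodic orbit contains a point of this orbit, hence is
finite. -/
lemma IsMinimalSubsystem.finite_of_mem_basin {X : Type*} [MetricSpace X] {T : X → X}
    {M : Set X} (hM : IsMinimalSubsystem T M) {x a : X} (hx : x ∈ M)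
    (ha : a ∈ Function.periodicPts T) (hb : x ∈ basin T (orbit T a)) : M.Finite := by
  have hfin := orbit_finite ha
  have hmem : ∃ y ∈ orbit T a, y ∈ M := by
    by_contra! hcon
    -- The finite orbit has positive distance from the closed set `M`.
    obtain ⟨δ, hδ, hd⟩ := (Set.disjoint_left.2 hcon).exists_thickenings hfin.isCompact hM.2.1
    obtain ⟨m, hm⟩ := (Tendsto.eventually_lt_const hδ hb).exists
    refine Set.disjoint_left.1 hd ?_ (Metric.self_subset_thickening hδ M (hM.2.2.1.iterate m hx))
    rw [Metric.mem_thickening_iff]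
    exact (Metric.infDist_lt_iff (show (orbit T a).Nonempty from ⟨a, 0, rfl⟩)).1 hm
  obtain ⟨_, ⟨j, rfl⟩, hy⟩ := hmem
  refine hfin.subset ((hM.2.2.2 _ hy).trans (hfin.isClosed.closure_subset_iff.2 ?_))
  rintro _ ⟨i, rfl⟩
  exact ⟨i + j, Function.iterate_add_apply _ _ _ _⟩

end Decomposition

end PadicDynamics

open PadicDynamics in
theorem theorem1p1 (p : ℕ) [Fact p.Prime] (K : Type*) [NormedField K] [NormedAlgebra ℚ_[p] K]
    [IsUltrametricDist K] [FiniteDimensional ℚ_[p] K]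
    (e f : ℕ) (he : PadicDynamics.IsRamificationIndex p K e) (hf : Nat.card 𝓀[K] = p ^ f)
    (π : 𝒪[K]) (hπ : PadicDynamics.IsUniformizer p e π)
    (φ : 𝒪[K]⟦X⟧) (hφ : PadicDynamics.IsConvergent φ)
    (hiter : ∀ n : ℕ, 1 ≤ n → (PadicDynamics.toMap φ)^[n] ≠ id) :
    ∃ (A B C : Set 𝒪[K]) (𝓑 : Set (Set 𝒪[K])),
      A ∪ B ∪ C = Set.univ ∧ Disjoint A B ∧ Disjoint A C ∧ Disjoint B C ∧
      A = Function.periodicPts (PadicDynamics.toMap φ) ∧ A.Finite ∧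
      𝓑.Countable ∧ 𝓑.PairwiseDisjoint id ∧ B = ⋃₀ 𝓑 ∧
      (∀ S ∈ 𝓑, PadicDynamics.IsComponent p e f φ π S) ∧
      (∀ S : Set 𝒪[K], PadicDynamics.IsComponent p e f φ π S → S ⊆ B) ∧
      (∀ x ∈ C,
        (∃ a ∈ A, x ∈ PadicDynamics.basin (PadicDynamics.toMap φ)
          (PadicDynamics.orbit (PadicDynamics.toMap φ) a)) ∨
        (∃ S ∈ 𝓑, x ∈ PadicDynamics.basin (PadicDynamics.toMap φ) S)) ∧
      (Module.finrank ℚ_[p] K ≠ 1 →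
        (∀ S ∈ 𝓑, ¬ {M : Set 𝒪[K] |
          M ⊆ S ∧ PadicDynamics.IsMinimalSubsystem (PadicDynamics.toMap φ) M}.Countable) ∧
        ((∃ M : Set 𝒪[K], M.Infinite ∧
            PadicDynamics.IsMinimalSubsystem (PadicDynamics.toMap φ) M) →
          ¬ {M : Set 𝒪[K] |
            PadicDynamics.IsMinimalSubsystem (PadicDynamics.toMap φ) M}.Countable)) := by
  have hproper : ProperSpace K := FiniteDimensional.proper ℚ_[p] K
  have hcompact : CompactSpace 𝒪[K] := by
    have h : ((𝒪[K] : Subring K) : Set K) = Metric.closedBall 0 1 := by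
      ext x
      rw [mem_closedBall_zero_iff]
      exact mem_integer_iff
    exact isCompact_iff_compactSpace.1 (h ▸ isCompact_closedBall (0 : K) 1)
  have hT := hφ.hasTaylor
  set 𝓑 : Set (Set 𝒪[K]) := {S | IsComponent p e f φ π S ∧
    ∀ S', IsComponent p e f φ π S' → S ⊆ S' → S' = S} with h𝓑
  have hmax : ∀ S, IsComponent p e f φ π S → ∃ S' ∈ 𝓑, S ⊆ S' := by
    intro S hS
    obtain ⟨-, -, ⟨x, hx⟩, -⟩ := hS.exists_level hφ he hπ
    obtain ⟨S', hS', h⟩ := hS.exists_maximal hφ he hπ hx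
    exact ⟨S', ⟨hS', fun S'' hS'' hsub =>
      (h S'' hS'' (hsub (h S hS hx hx))).antisymm hsub⟩, h S hS hx⟩
  have hdisj : 𝓑.PairwiseDisjoint id := by
    intro S₁ h₁ S₂ h₂ hne
    rw [Function.onFun, id, id, Set.disjoint_left]
    intro x hx₁ hx₂
    obtain ⟨S', hS', h⟩ := h₁.1.exists_maximal hφ he hπ hx₁
    exact hne ((h₁.2 S' hS' (h _ h₁.1 hx₁)).symm.trans (h₂.2 S' hS' (h _ h₂.1 hx₂)))
  have hcountable : 𝓑.Countable := hdisj.countable_of_isOpen (fun S hS => hS.1.1.2) fun S hS => by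
    obtain ⟨-, -, hne, -⟩ := hS.1.exists_level hφ he hπ
    exact hne
  have hAB : Disjoint (Function.periodicPts (toMap φ)) (⋃₀ 𝓑) := by
    rw [Set.disjoint_left]
    rintro x ⟨N, hN, hx⟩ ⟨S, hS, hxS⟩
    exact hS.1.not_periodic hφ he hπ hxS hN hx
  have hbasin : ∀ x : 𝒪[K], (∃ a ∈ Function.periodicPts (toMap φ),
      x ∈ basin (toMap φ) (orbit (toMap φ) a)) ∨ ∃ S ∈ 𝓑, x ∈ basin (toMap φ) S := by
    intro x
    rcases hφ.mem_basin he hf hπ x with h | ⟨S, hS, j, hj⟩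
    · exact Or.inl h
    · obtain ⟨S', hS', hsub⟩ := hmax S hS
      exact Or.inr ⟨S', hS', mem_basin_of_iterate_mem hS'.1.2.1 (hsub hj)⟩
  have hunc : Module.finrank ℚ_[p] K ≠ 1 → ∀ S ∈ 𝓑, ¬ {M : Set 𝒪[K] |
      M ⊆ S ∧ IsMinimalSubsystem (toMap φ) M}.Countable := by
    intro hK S hS
    obtain ⟨n, hn, hne, hvis, hpat⟩ := hS.1.exists_level hφ he hπ
    exact hT.not_countable_minimal he hπ hK hn hne hvis hpat
  refine ⟨Function.periodicPts (toMap φ), ⋃₀ 𝓑, (Function.periodicPts (toMap φ) ∪ ⋃₀ 𝓑)ᶜ, 𝓑,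
    Set.union_compl_self _, hAB, Set.disjoint_compl_right_iff_subset.2 Set.subset_union_left,
    Set.disjoint_compl_right_iff_subset.2 Set.subset_union_right, rfl,
    hφ.finite_periodicPts he hf hπ hiter, hcountable, hdisj, rfl, fun S hS => hS.1, ?_,
    fun x _ => hbasin x, fun hK => ⟨hunc hK, ?_⟩⟩
  · intro S hS
    obtain ⟨S', hS', hsub⟩ := hmax S hS
    exact hsub.trans (Set.subset_sUnion_of_mem hS')
  · rintro ⟨M, hinf, hM⟩ hcount
    obtain ⟨x, hx⟩ := hM.1
    rcases hbasin x with ⟨a, ha, hxa⟩ | ⟨S, hS, -⟩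
    · exact hinf (hM.finite_of_mem_basin hx ha hxa)
    · exact hunc hK S hS (hcount.mono fun M hM => hM.2)
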